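/- Let $n\in\mathbb N$, let $\|\cdot\|$ be a norm on $\mathbb R^n$, and give the space $\mathcal L(\mathbb R^n)$ of linear maps of $\mathbb R^n$ the operator norm. Let $A:[0,\infty)\to\mathcal L(\mathbb R^n)$ have bounded variation on every compact interval, and suppose that $I-(A(t)-A(t^-))$ is invertible for every $t>0$ and that $I+(A(t^+)-A(t))$ is invertible for every $t\ge 0$. For a normed space $X$ and $G:[a,b]\times[a,b]\to X$, the Kurzweil integral $\int_a^b DG(\tau,t)$ is the element $\mathcal I\in X$ (if there is one) such that for every $\varepsilon>0$ there is a function $\delta:[a,b]\to(0,\infty)$ with $$\Big\|\sum_{j=1}^{m}\big[G(\tau_j,\alpha_j)-G(\tau_j,\alpha_{j-1})\big]-\mathcal I\Big\|<\varepsilon$$ for all $a=\alpha_0<\alpha_1<\dots<\alpha_m=b$ and $\tau_j\in[\alpha_{j-1},\alpha_j]$ with $[\alpha_{j-1},\alpha_j]\subset(\tau_j-\delta(\tau_j),\tau_j+\delta(\tau_j))$ for all $j$; moreover $\int_b^a=-\int_a^b$ and $\int_a^a=0$. Write $\int_a^b d[A(r)]\,y(r)$ for this integral with $G(\tau,t)=A(t)y(\tau)$,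 where $y$ has values in $\mathbb R^n$ or in $\mathcal L(\mathbb R^n)$. Consider the homogeneous generalized linear differential equation (GLDE) $$\frac{dx}{d\tau}=D[A(t)x].$$ A function $x:J\to\mathbb R^n$ on an interval $J\subset[0,\infty)$ is a solution of it on $J$ if, for all $[c,d]\subset J$, the integral $\int_c^d d[A(r)]\,x(r)$ exists and equals $x(d)-x(c)$. Its transition matrix is the uniquely determined function $U:[0,\infty)\times[0,\infty)\to\mathcal L(\mathbb R^n)$ with $$U(t,s)=I+\int_s^t d[A(r)]\,U(r,s)\qquad\text{for all } t,s\ge 0.$$ The trivial solution is called stable if for every $s_0\ge0$ and every $\varepsilon>0$ there is $\delta>0$ such that, whenever $x_0\in\mathbb R^n$, $\|x_0\|<\delta$, and $x$ is the solution on $[s_0,\infty)$ with $x(s_0)=x_0$, then $\|x(t)\|<\varepsilon$ for all $t\ge s_0$. Then the trivial solution of the homogeneous GLDE is stable if and only if for every $s_0\ge 0$ there is a constant $C=C(s_0)>0$ such that $\|U(t,s_0)\|\le C$ for all $t\ge s_0$. -/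

import Mathlib

open Set

namespace GLDE

section KurzweilIntegral

variable {X : Type*} [NormedAddCommGroup X]

/-- `α 0 = a < α 1 < ... < α n = b` is a partition of `[a, b]` and `τ j` is a tag of its
`j`-th interval `[α j, α (j + 1)]`, for `j < n`. -/
structure IsTaggedPartition (a b : ℝ) (n : ℕ) (α τ : ℕ → ℝ) : Prop where
  left_eq : α 0 = a
  right_eq : α n = b
  lt_succ : ∀ j < n, α j < α (j + 1)
  tag_mem : ∀ j < n, τ j ∈ Icc (α j) (α (j + 1))

/-- A gauge on `[a, b]` is a function that is positive there. -/
def IsGauge (a b : ℝ) (δ : ℝ → ℝ) : Prop :=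
  ∀ t ∈ Icc a b, 0 < δ t

/-- The tagged partition given by `n`, `α`, `τ` is `δ`-fine. -/
def IsFine (δ : ℝ → ℝ) (n : ℕ) (α τ : ℕ → ℝ) : Prop :=
  ∀ j < n, Icc (α j) (α (j + 1)) ⊆ Ioo (τ j - δ (τ j)) (τ j + δ (τ j))

/-- The integral sum of `G` for the tagged partition given by `n`, `α`, `τ`. -/
def kurzweilSum (G : ℝ → ℝ → X) (n : ℕ) (α τ : ℕ → ℝ) : X :=
  ∑ j ∈ Finset.range n, (G (τ j) (α (j + 1)) - G (τ j) (α j))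

/-- `G` is Kurzweil integrable on the compact interval `[a, b]`, `a ≤ b`, with integral `I`. -/
def HasKurzweilIntegralOn (G : ℝ → ℝ → X) (a b : ℝ) (I : X) : Prop :=
  ∀ ε > 0, ∃ δ : ℝ → ℝ, IsGauge a b δ ∧
    ∀ (n : ℕ) (α τ : ℕ → ℝ), IsTaggedPartition a b n α τ → IsFine δ n α τ →
      ‖kurzweilSum G n α τ - I‖ < ε

/-- The oriented Kurzweil integral `∫_a^b D G(τ, t)` exists and equals `I`; if `b < a` this
means that `∫_b^a D G(τ, t)` exists and equals `-I`. If `a = b` then the only partition has no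
intervals, so both clauses say that `I = 0`. -/
def HasKurzweilIntegral (G : ℝ → ℝ → X) (a b : ℝ) (I : X) : Prop :=
  (a ≤ b → HasKurzweilIntegralOn G a b I) ∧ (b ≤ a → HasKurzweilIntegralOn G b a (-I))

end KurzweilIntegral

section Equation

variable {E : Type*} [NormedAddCommGroup E] [NormedSpace ℝ E]

/-- `x` is a solution on the interval `J` of the generalized differential equation
`dx/dτ = D F(x, t)`. -/
def IsGODESolution (F : E → ℝ → E) (J : Set ℝ) (x : ℝ → E) : Prop :=
  ∀ c d : ℝ, c ≤ d → Icc c d ⊆ J →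
    HasKurzweilIntegral (fun τ t => F (x τ) t) c d (x d - x c)

/-- `x` is a solution on the interval `J` of the homogeneous generalized linear differential
equation `dx/dτ = D[A(t) x]`. -/
def IsSolution (A : ℝ → E →L[ℝ] E) (J : Set ℝ) (x : ℝ → E) : Prop :=
  IsGODESolution (fun y t => A t y) J x

/-- Condition (D): `I - Δ⁻A(t)` is invertible for all `t > 0` and `I + Δ⁺A(t)` is invertible for
all `t ≥ 0`, where `Δ⁻A(t) = A(t) - A(t⁻)` and `Δ⁺A(t) = A(t⁺) - A(t)`. -/
def ConditionD (A : ℝ → E →L[ℝ] E) : Prop :=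
  (∀ t > 0, IsUnit (1 - (A t - Function.leftLim A t))) ∧
    ∀ t ≥ 0, IsUnit (1 + (Function.rightLim A t - A t))

/-- `U` satisfies `U(t, s) = I + ∫_s^t d[A(r)] U(r, s)` for all `t, s ≥ 0`. -/
def IsTransitionMatrix (A : ℝ → E →L[ℝ] E) (U : ℝ → ℝ → E →L[ℝ] E) : Prop :=
  ∀ t ≥ 0, ∀ s ≥ 0, HasKurzweilIntegral (fun τ r => A r * U τ s) s t (U t s - 1)

/-- The transition matrix `U(t, s)` of `dx/dτ = D[A(t) x]`. For `A` of locally bounded variation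
on `[0, ∞)` with condition (D), on a finite-dimensional space, there is one function on
`[0, ∞) × [0, ∞)` with the defining property, and this is the function that is chosen; its values
at other arguments are irrelevant. -/
noncomputable def transitionMatrix (A : ℝ → E →L[ℝ] E) : ℝ → ℝ → E →L[ℝ] E :=
  Classical.epsilon (IsTransitionMatrix A)

/-- The trivial solution of `dx/dτ = D[A(t) x]` is stable: for all `s₀ ≥ 0` and `ε > 0` there is
`δ > 0` such that the solution on `[s₀, ∞)` with `x(s₀) = x₀`, `‖x₀‖ < δ`, stays below `ε`. -/
def IsStable (A : ℝ → E →L[ℝ] E) : Prop :=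
  ∀ s₀ ≥ 0, ∀ ε > 0, ∃ δ > 0, ∀ x₀ : E, ‖x₀‖ < δ →
    ∀ x : ℝ → E, IsSolution A (Ici s₀) x → x s₀ = x₀ → ∀ t ≥ s₀, ‖x t‖ < ε

end Equation

end GLDE

namespace GLDE

open Filter Topology

/-! Given the transition matrix, the equivalence is linear algebra: every solution on `[s₀, ∞)` is
`t ↦ U(t, s₀) x₀`. Stability for `ε = 1` bounds `U(t, s₀)` on a small ball, hence in operator norm;
conversely a bound `C` makes `δ = ε / C` work. The substance is that `U` exists and that initial
values determine solutions.

Both are proved for a coefficient on the whole line whose increments are dominated by those of a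
monotone `v`; the given `A` is extended by `A 0` to the left of `0`, with its variation as `v`.
Where `v` grows by at most `1/2`, integration against `dA` halves the sup norm: Picard iteration
converges, and a bounded solution with a zero vanishes.

A jump can make the variation large on every interval starting at a point `a`. Replacing `A a` by
`A(a⁺)` removes that jump, and the two equations have the same solutions on `(a, b]`, their values
at `a` being related by the invertible operator `I + Δ⁺A(a)`. The reflection `t ↦ -t` turns this
into the statement at left-hand neighbourhoods, where `I - Δ⁻A` appears. `cousin_induction` passes
from these one-sided statements to compact intervals (`exists_isSolOn`, `eq_zero_iff`). Applied to
left multiplication by `A(t)` on the operator algebra, existence yields `U`. -/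

theorem eventually_nhdsGT_iff_exists {p : ℝ → Prop} {t : ℝ} :
    (∀ᶠ s in 𝓝[>] t, p s) ↔ ∃ δ > 0, ∀ s ∈ Ioo t (t + δ), p s := by
  rw [Filter.Eventually, mem_nhdsGT_iff_exists_Ioo_subset]
  refine ⟨fun ⟨u, hu, h⟩ => ⟨u - t, sub_pos.2 hu, fun s hs => h (by simpa using hs)⟩,
    fun ⟨δ, hδ, h⟩ => ⟨t + δ, lt_add_of_pos_right t hδ, h⟩⟩

theorem eventually_nhdsLT_iff_exists {p : ℝ → Prop} {t : ℝ} :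
    (∀ᶠ s in 𝓝[<] t, p s) ↔ ∃ δ > 0, ∀ s ∈ Ioo (t - δ) t, p s := by
  rw [Filter.Eventually, mem_nhdsLT_iff_exists_Ioo_subset]
  refine ⟨fun ⟨u, hu, h⟩ => ⟨t - u, sub_pos.2 hu, fun s hs => h (by simpa using hs)⟩,
    fun ⟨δ, hδ, h⟩ => ⟨t - δ, sub_lt_self t hδ, h⟩⟩

/-- An additive property of compact intervals which holds locally on both sides of every point
holds on every compact interval. -/
theorem cousin_induction {P : ℝ → ℝ → Prop} {a b : ℝ} (hab : a ≤ b) (hrefl : ∀ t, P t t)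
    (htrans : ∀ r s t, a ≤ r → r ≤ s → s ≤ t → t ≤ b → P r s → P s t → P r t)
    (hright : ∀ t ∈ Ico a b, ∀ᶠ s in 𝓝[>] t, s ≤ b → P t s)
    (hleft : ∀ t ∈ Ioc a b, ∀ᶠ s in 𝓝[<] t, a ≤ s → P s t) : P a b := by
  set S : Set ℝ := {t | t ∈ Icc a b ∧ P a t} with hS
  have haS : a ∈ S := ⟨⟨le_rfl, hab⟩, hrefl a⟩
  have hbdd : BddAbove S := ⟨b, fun t ht => ht.1.2⟩
  have has : a ≤ sSup S := le_csSup hbdd haS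
  have hsb : sSup S ≤ b := csSup_le ⟨a, haS⟩ fun t ht => ht.1.2
  have hPs : P a (sSup S) := by
    rcases has.eq_or_lt with h | h
    · rw [← h]; exact hrefl a
    · obtain ⟨δ, hδ, hP⟩ := eventually_nhdsLT_iff_exists.1 (hleft (sSup S) ⟨h, hsb⟩)
      obtain ⟨t, htS, ht⟩ := exists_lt_of_lt_csSup ⟨a, haS⟩ (sub_lt_self (sSup S) hδ)
      rcases (le_csSup hbdd htS).eq_or_lt with h' | h'
      · rw [← h']; exact htS.2
      · exact htrans a t _ le_rfl htS.1.1 h'.le hsb htS.2 (hP t ⟨ht, h'⟩ htS.1.1)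
  rcases hsb.eq_or_lt with h | h
  · rw [← h]; exact hPs
  · obtain ⟨δ, hδ, hP⟩ := eventually_nhdsGT_iff_exists.1 (hright (sSup S) ⟨has, h⟩)
    have h1 : sSup S < min b (sSup S + δ / 2) := lt_min h (by linarith)
    have h2 : min b (sSup S + δ / 2) ∈ S := by
      refine ⟨⟨has.trans h1.le, min_le_left _ _⟩,
        htrans a _ _ le_rfl has h1.le (min_le_left _ _) hPs (hP _ ⟨h1, ?_⟩ (min_le_left _ _))⟩
      exact (min_le_right _ _).trans_lt (by linarith)
    exact absurd (le_csSup hbdd h2) (not_le.2 h1)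

/-! ### Fine tagged partitions as lists, and their integral sums -/

/-- `l` lists the tagged intervals `(τ, u, v)` of a `δ`-fine tagged partition of `[a, b]`. -/
inductive IsFineList (δ : ℝ → ℝ) : ℝ → ℝ → List (ℝ × ℝ × ℝ) → Prop
  | nil (a : ℝ) : IsFineList δ a a []
  | cons {a b c τ : ℝ} {l : List (ℝ × ℝ × ℝ)} : a < b → τ ∈ Icc a b →
      Icc a b ⊆ Ioo (τ - δ τ) (τ + δ τ) → IsFineList δ b c l → IsFineList δ a c ((τ, a, b) :: l)

namespace IsFineList

variable {δ δ' : ℝ → ℝ} {a b c : ℝ} {l l' : List (ℝ × ℝ × ℝ)}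

theorem le (h : IsFineList δ a b l) : a ≤ b := by
  induction h with
  | nil => exact le_rfl
  | cons h _ _ _ ih => exact h.le.trans ih

theorem mono (h : IsFineList δ a b l) (hδ : ∀ t ∈ Icc a b, δ t ≤ δ' t) :
    IsFineList δ' a b l := by
  induction h with
  | nil => exact .nil _
  | @cons a b c τ l hab hτ hf hl ih =>
    have hbc := hl.le
    have h1 := hδ τ ⟨hτ.1, hτ.2.trans hbc⟩
    refine .cons hab hτ (hf.trans (Ioo_subset_Ioo (by linarith) (by linarith)))
      (ih fun t ht => hδ t ⟨hab.le.trans ht.1, ht.2⟩)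

theorem append (h : IsFineList δ a b l) (h' : IsFineList δ b c l') :
    IsFineList δ a c (l ++ l') := by
  induction h with
  | nil => exact h'
  | cons hab hτ hf _ ih => exact .cons hab hτ hf (ih h')

theorem single {τ : ℝ} (hab : a < b) (hτ : τ ∈ Icc a b)
    (hf : Icc a b ⊆ Ioo (τ - δ τ) (τ + δ τ)) : IsFineList δ a b [(τ, a, b)] :=
  .cons hab hτ hf (.nil _)

/-- Cousin's lemma: one interval tagged at `t` is fine on either side of `t`, and lists concatenate.
Without it the integral would not be unique. -/
theorem exists_of_isGauge (hab : a ≤ b) (hδ : IsGauge a b δ) : ∃ l, IsFineList δ a b l := by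
  refine cousin_induction (P := fun r s => ∃ l, IsFineList δ r s l) hab (fun t => ⟨_, .nil t⟩)
    (fun r s t _ _ _ _ ⟨l, hl⟩ ⟨l', hl'⟩ => ⟨_, hl.append hl'⟩) ?_ ?_
  · intro t ht
    refine eventually_nhdsGT_iff_exists.2 ⟨δ t, hδ t ⟨ht.1, ht.2.le⟩, fun s hs _ =>
      ⟨_, single hs.1 ⟨le_rfl, hs.1.le⟩ ?_⟩⟩
    intro r hr
    exact ⟨by linarith [hr.1, hδ t ⟨ht.1, ht.2.le⟩], by linarith [hr.2, hs.2]⟩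
  · intro t ht
    refine eventually_nhdsLT_iff_exists.2 ⟨δ t, hδ t ⟨ht.1.le, ht.2⟩, fun s hs _ =>
      ⟨_, single hs.2 ⟨hs.2.le, le_rfl⟩ ?_⟩⟩
    intro r hr
    exact ⟨by linarith [hr.1, hs.1], by linarith [hr.2, hδ t ⟨ht.1.le, ht.2⟩]⟩

/-- Reflection exchanges left and right, so one-sided arguments need only be carried out at left
endpoints. -/
theorem neg (h : IsFineList δ a b l) : IsFineList (fun t => δ (-t)) (-b) (-a)
    (l.map fun p => (-p.1, -p.2.2, -p.2.1)).reverse := by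
  induction h with
  | nil => exact .nil _
  | @cons a b c τ l hab hτ hf hl ih =>
    rw [List.map_cons, List.reverse_cons]
    refine ih.append (single (by linarith) ⟨by linarith [hτ.2], by linarith [hτ.1]⟩ ?_)
    intro t ht
    have := hf (show -t ∈ Icc a b from ⟨by linarith [ht.2], by linarith [ht.1]⟩)
    rw [neg_neg]
    exact ⟨by linarith [this.2], by linarith [this.1]⟩

end IsFineList

section Sum

variable {X : Type*} [NormedAddCommGroup X]

/-- The integral sum of `G` over a list of tagged intervals. -/
def listSum (G : ℝ → ℝ → X) (l : List (ℝ × ℝ × ℝ)) : X :=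
  (l.map fun p => G p.1 p.2.2 - G p.1 p.2.1).sum

@[simp] theorem listSum_nil (G : ℝ → ℝ → X) : listSum G [] = 0 := rfl

@[simp] theorem listSum_cons (G : ℝ → ℝ → X) (τ u v : ℝ) (l : List (ℝ × ℝ × ℝ)) :
    listSum G ((τ, u, v) :: l) = G τ v - G τ u + listSum G l := by
  simp [listSum]

theorem listSum_append (G : ℝ → ℝ → X) (l l' : List (ℝ × ℝ × ℝ)) :
    listSum G (l ++ l') = listSum G l + listSum G l' := by
  simp [listSum]

theorem listSum_neg (G : ℝ → ℝ → X) (l : List (ℝ × ℝ × ℝ)) :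
    listSum (fun τ t => G (-τ) (-t)) (l.map fun p => (-p.1, -p.2.2, -p.2.1)).reverse =
      -listSum G l := by
  induction l with
  | nil => simp [listSum]
  | cons p l ih =>
    obtain ⟨τ, u, v⟩ := p
    rw [List.map_cons, List.reverse_cons, listSum_append, ih]
    simp only [listSum_cons, listSum_nil, neg_neg]
    abel

theorem listSum_sub (G H : ℝ → ℝ → X) (l : List (ℝ × ℝ × ℝ)) :
    listSum (fun τ t => G τ t - H τ t) l = listSum G l - listSum H l := by
  induction l with
  | nil => simp [listSum]
  | cons p l ih =>
    obtain ⟨τ, u, v⟩ := p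
    simp only [listSum_cons, ih]
    abel

theorem IsFineList.listSum_congr {δ : ℝ → ℝ} {a b : ℝ} {l : List (ℝ × ℝ × ℝ)}
    (h : IsFineList δ a b l) {G H : ℝ → ℝ → X}
    (hGH : ∀ s ∈ Icc a b, ∀ t ∈ Icc a b, G s t = H s t) : listSum G l = listSum H l := by
  induction h with
  | nil => rfl
  | @cons a b c τ l hab hτ hf hl ih =>
    have hbc := hl.le
    have hτ' : τ ∈ Icc a c := ⟨hτ.1, hτ.2.trans hbc⟩
    rw [listSum_cons, listSum_cons, hGH _ hτ' _ ⟨hab.le, hbc⟩, hGH _ hτ' _ ⟨le_rfl, hab.le.trans hbc⟩,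
      ih fun s hs t ht => hGH s ⟨hab.le.trans hs.1, hs.2⟩ t ⟨hab.le.trans ht.1, ht.2⟩]

theorem IsFineList.listSum_of_forall_eq {δ : ℝ → ℝ} {a b : ℝ} {l : List (ℝ × ℝ × ℝ)}
    (h : IsFineList δ a b l) (g : ℝ → X) : listSum (fun _ t => g t) l = g b - g a := by
  induction h with
  | nil => simp
  | cons hab hτ hf hl ih => rw [listSum_cons, ih]; abel

theorem IsFineList.exists_isTaggedPartition {δ : ℝ → ℝ} {a b : ℝ} {l : List (ℝ × ℝ × ℝ)}
    (h : IsFineList δ a b l) (G : ℝ → ℝ → X) : ∃ (n : ℕ) (α τ : ℕ → ℝ),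
      IsTaggedPartition a b n α τ ∧ IsFine δ n α τ ∧ kurzweilSum G n α τ = listSum G l := by
  induction h with
  | nil a =>
    exact ⟨0, fun _ => a, fun _ => a, ⟨rfl, rfl, by simp, by simp⟩, by simp [IsFine],
      by simp [kurzweilSum]⟩
  | @cons a b c σ l hab hσ hf hl ih =>
    obtain ⟨n, α, τ, h1, h2, h3⟩ := ih
    refine ⟨n + 1, fun j => Nat.casesOn j a α, fun j => Nat.casesOn j σ τ,
      ⟨rfl, h1.right_eq, ?_, ?_⟩, ?_, ?_⟩
    · rintro (_ | j) hj
      · simpa [h1.left_eq] using hab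
      · exact h1.lt_succ j (by omega)
    · rintro (_ | j) hj
      · simpa [h1.left_eq] using hσ
      · exact h1.tag_mem j (by omega)
    · rintro (_ | j) hj
      · simpa [h1.left_eq] using hf
      · exact h2 j (by omega)
    · rw [listSum_cons, ← h3, kurzweilSum, Finset.sum_range_succ', add_comm]
      simp [kurzweilSum, h1.left_eq]

theorem IsTaggedPartition.exists_isFineList {δ : ℝ → ℝ} {n : ℕ} (G : ℝ → ℝ → X) {a b : ℝ}
    {α τ : ℕ → ℝ} (h : IsTaggedPartition a b n α τ) (hf : IsFine δ n α τ) :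
    ∃ l, IsFineList δ a b l ∧ listSum G l = kurzweilSum G n α τ := by
  induction n generalizing a α τ with
  | zero =>
    obtain rfl : a = b := h.left_eq.symm.trans h.right_eq
    exact ⟨[], .nil _, by simp [kurzweilSum]⟩
  | succ n ih =>
    obtain ⟨l, hl, hs⟩ := ih (a := α 1) (α := fun j => α (j + 1)) (τ := fun j => τ (j + 1))
      ⟨rfl, h.right_eq, fun j hj => h.lt_succ _ (by omega), fun j hj => h.tag_mem _ (by omega)⟩
      (fun j hj => hf _ (by omega))
    have h1 := h.lt_succ 0 (by omega)
    have h2 := h.tag_mem 0 (by omega)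
    have h3 := hf 0 (by omega)
    rw [h.left_eq] at h1 h2 h3
    refine ⟨_, .cons h1 h2 h3 hl, ?_⟩
    rw [listSum_cons, hs, kurzweilSum, kurzweilSum, Finset.sum_range_succ', add_comm]
    simp [h.left_eq]

theorem hasKurzweilIntegralOn_iff {G : ℝ → ℝ → X} {a b : ℝ} {I : X} :
    HasKurzweilIntegralOn G a b I ↔ ∀ ε > 0, ∃ δ : ℝ → ℝ, IsGauge a b δ ∧
      ∀ l, IsFineList δ a b l → ‖listSum G l - I‖ < ε := by
  refine forall₂_congr fun ε _ => exists_congr fun δ => and_congr_right fun _ => ⟨?_, ?_⟩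
  · intro h l hl
    obtain ⟨n, α, τ, h1, h2, h3⟩ := hl.exists_isTaggedPartition G
    rw [← h3]
    exact h n α τ h1 h2
  · intro h n α τ h1 h2
    obtain ⟨l, hl, h3⟩ := h1.exists_isFineList G h2
    rw [← h3]
    exact h l hl

end Sum

theorem IsGauge.min {a b a' b' : ℝ} {δ δ' : ℝ → ℝ} (h : IsGauge a b δ) (h' : IsGauge a' b' δ')
    {c d : ℝ} (hs : Icc c d ⊆ Icc a b) (hs' : Icc c d ⊆ Icc a' b') :
    IsGauge c d (fun t => min (δ t) (δ' t)) :=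
  fun t ht => lt_min (h t (hs ht)) (h' t (hs' ht))

/-! ### Basic properties of the Kurzweil integral -/

namespace HasKurzweilIntegralOn

variable {X : Type*} [NormedAddCommGroup X] {G H : ℝ → ℝ → X} {a b c : ℝ} {I J : X}

theorem exists_gauge (h : HasKurzweilIntegralOn G a b I) {ε : ℝ} (hε : 0 < ε) :
    ∃ δ : ℝ → ℝ, IsGauge a b δ ∧ ∀ l, IsFineList δ a b l → ‖listSum G l - I‖ < ε :=
  hasKurzweilIntegralOn_iff.1 h ε hε

theorem exists_isFineList (h : HasKurzweilIntegralOn G a b I) (hab : a ≤ b) {ε : ℝ} (hε : 0 < ε)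
    {δ : ℝ → ℝ} (hδ : IsGauge a b δ) :
    ∃ l, IsFineList δ a b l ∧ ‖listSum G l - I‖ < ε := by
  obtain ⟨δ', hδ', hl⟩ := h.exists_gauge hε
  obtain ⟨l, hfl⟩ := IsFineList.exists_of_isGauge hab (hδ.min hδ' Subset.rfl Subset.rfl)
  exact ⟨l, hfl.mono fun t _ => min_le_left _ _, hl l (hfl.mono fun t _ => min_le_right _ _)⟩

theorem norm_sub_le_of_forall (h : HasKurzweilIntegralOn G a b I) (hab : a ≤ b) {δ : ℝ → ℝ}
    (hδ : IsGauge a b δ) {C : ℝ} {x : X} (hC : ∀ l, IsFineList δ a b l → ‖listSum G l - x‖ ≤ C) :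
    ‖I - x‖ ≤ C := by
  refine le_of_forall_pos_le_add fun ε hε => ?_
  obtain ⟨l, hl, hl'⟩ := h.exists_isFineList hab hε hδ
  calc ‖I - x‖ = ‖(listSum G l - x) - (listSum G l - I)‖ := by congr 1; abel
    _ ≤ _ := norm_sub_le _ _
    _ ≤ C + ε := add_le_add (hC l hl) hl'.le

theorem unique (h : HasKurzweilIntegralOn G a b I) (h' : HasKurzweilIntegralOn G a b J)
    (hab : a ≤ b) : I = J := by
  refine eq_of_sub_eq_zero (norm_le_zero_iff.1 (le_of_forall_pos_le_add fun ε hε => ?_))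
  obtain ⟨δ, hδ, hl⟩ := h'.exists_gauge hε
  rw [zero_add]
  exact h.norm_sub_le_of_forall hab hδ fun l hfl => (hl l hfl).le

theorem refl (G : ℝ → ℝ → X) (a : ℝ) : HasKurzweilIntegralOn G a a 0 := by
  refine hasKurzweilIntegralOn_iff.2 fun ε hε => ⟨fun _ => 1, fun _ _ => one_pos, fun l hl => ?_⟩
  cases hl with
  | nil => simpa using hε
  | cons h _ _ h' => exact absurd h'.le (not_le.2 h)

theorem congr (h : HasKurzweilIntegralOn G a b I)
    (hGH : ∀ s ∈ Icc a b, ∀ t ∈ Icc a b, G s t = H s t) : HasKurzweilIntegralOn H a b I := by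
  refine hasKurzweilIntegralOn_iff.2 fun ε hε => ?_
  obtain ⟨δ, hδ, hl⟩ := h.exists_gauge hε
  exact ⟨δ, hδ, fun l hfl => hfl.listSum_congr hGH ▸ hl l hfl⟩

theorem of_forall_eq (g : ℝ → X) (a b : ℝ) :
    HasKurzweilIntegralOn (fun _ t => g t) a b (g b - g a) := by
  refine hasKurzweilIntegralOn_iff.2 fun ε hε => ⟨fun _ => 1, fun _ _ => one_pos, fun l hl => ?_⟩
  rwa [hl.listSum_of_forall_eq, sub_self, norm_zero]

theorem neg (h : HasKurzweilIntegralOn G a b I) :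
    HasKurzweilIntegralOn (fun τ t => G (-τ) (-t)) (-b) (-a) (-I) := by
  refine hasKurzweilIntegralOn_iff.2 fun ε hε => ?_
  obtain ⟨δ, hδ, hl⟩ := h.exists_gauge hε
  refine ⟨fun t => δ (-t), fun t ht => hδ _ ⟨by linarith [ht.2], by linarith [ht.1]⟩,
    fun l hfl => ?_⟩
  have h1 := hfl.neg
  simp only [neg_neg] at h1
  have h2 := listSum_neg (fun τ t => G (-τ) (-t)) l
  simp only [neg_neg] at h2
  have h3 := hl _ h1
  rw [h2] at h3
  have h4 : -listSum (fun τ t => G (-τ) (-t)) l - I =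
      -(listSum (fun τ t => G (-τ) (-t)) l - -I) := by abel
  rwa [h4, norm_neg] at h3

theorem sub (h : HasKurzweilIntegralOn G a b I) (h' : HasKurzweilIntegralOn H a b J) :
    HasKurzweilIntegralOn (fun τ t => G τ t - H τ t) a b (I - J) := by
  refine hasKurzweilIntegralOn_iff.2 fun ε hε => ?_
  obtain ⟨δ, hδ, hl⟩ := h.exists_gauge (half_pos hε)
  obtain ⟨δ', hδ', hl'⟩ := h'.exists_gauge (half_pos hε)
  refine ⟨_, hδ.min hδ' Subset.rfl Subset.rfl, fun l hfl => ?_⟩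
  have h1 := hl l (hfl.mono fun t _ => min_le_left _ _)
  have h2 := hl' l (hfl.mono fun t _ => min_le_right _ _)
  rw [listSum_sub]
  calc _ = ‖(listSum G l - I) - (listSum H l - J)‖ := by congr 1; abel
    _ ≤ _ := norm_sub_le _ _
    _ < ε := by linarith

/-- Prepending one fixed fine partition of `[a, c]`, with sum close to `J`, to a fine partition of
`[c, b]` gives a fine partition of `[a, b]`. -/
theorem sub_left (h : HasKurzweilIntegralOn G a b I) (h' : HasKurzweilIntegralOn G a c J)
    (hac : a ≤ c) (hcb : c ≤ b) : HasKurzweilIntegralOn G c b (I - J) := by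
  refine hasKurzweilIntegralOn_iff.2 fun ε hε => ?_
  obtain ⟨δ, hδ, hl⟩ := h.exists_gauge (half_pos hε)
  obtain ⟨m, hm, hm'⟩ := h'.exists_isFineList hac (half_pos hε)
    (fun t ht => hδ t ⟨ht.1, ht.2.trans hcb⟩)
  refine ⟨δ, fun t ht => hδ t ⟨hac.trans ht.1, ht.2⟩, fun l hfl => ?_⟩
  have h1 := hl _ (hm.append hfl)
  rw [listSum_append] at h1
  calc _ = ‖(listSum G m + listSum G l - I) - (listSum G m - J)‖ := by congr 1; abel
    _ ≤ _ := norm_sub_le _ _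
    _ < ε := by linarith

theorem map {Y : Type*} [NormedAddCommGroup Y] [NormedSpace ℝ X] [NormedSpace ℝ Y]
    (h : HasKurzweilIntegralOn G a b I) (L : X →L[ℝ] Y) :
    HasKurzweilIntegralOn (fun τ t => L (G τ t)) a b (L I) := by
  refine hasKurzweilIntegralOn_iff.2 fun ε hε => ?_
  obtain ⟨δ, hδ, hl⟩ := h.exists_gauge (show 0 < ε / (‖L‖ + 1) by positivity)
  refine ⟨δ, hδ, fun l hfl => ?_⟩
  have h1 : listSum (fun τ t => L (G τ t)) l = L (listSum G l) := by
    simp [listSum, map_list_sum, Function.comp_def]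
  rw [h1, ← map_sub]
  have h2 := hl l hfl
  rw [lt_div_iff₀ (by positivity)] at h2
  calc _ ≤ ‖L‖ * ‖listSum G l - I‖ := L.le_opNorm _
    _ ≤ ‖listSum G l - I‖ * (‖L‖ + 1) := by nlinarith [norm_nonneg (listSum G l - I)]
    _ < ε := h2

/-- Near the left end the indefinite integral is close to the integral sum of one interval. -/
theorem eventually_norm_sub_le (hab : a < b) {x : ℝ → X}
    (hx : ∀ t ∈ Icc a b, HasKurzweilIntegralOn G t b (x b - x t)) {ε : ℝ} (hε : 0 < ε) :
    ∀ᶠ t in 𝓝[>] a, t ≤ b → ‖x t - x a - (G a t - G a a)‖ ≤ ε := by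
  obtain ⟨δ, hδ, hl⟩ := (hx a ⟨le_rfl, hab.le⟩).exists_gauge (half_pos hε)
  have hδa := hδ a ⟨le_rfl, hab.le⟩
  refine eventually_nhdsGT_iff_exists.2 ⟨δ a, hδa, fun t ht htb => ?_⟩
  -- A one-interval Saks–Henstock argument: `m` sums to nearly the integral over `[t, b]`, and
  -- adding `[a, t]` with tag `a` gives nearly the integral over `[a, b]`; the difference is the
  -- claim.
  obtain ⟨m, hm, hm'⟩ := (hx t ⟨ht.1.le, htb⟩).exists_isFineList htb (half_pos hε)
    (fun s hs => hδ s ⟨ht.1.le.trans hs.1, hs.2⟩)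
  have h1 := hl _ (.cons ht.1 ⟨le_rfl, ht.1.le⟩
    (fun s hs => ⟨by linarith [hs.1], by linarith [hs.2, ht.2]⟩) hm)
  rw [listSum_cons] at h1
  calc _ = ‖(listSum G m - (x b - x t)) - (G a t - G a a + listSum G m - (x b - x a))‖ := by
        congr 1; abel
    _ ≤ _ := norm_sub_le _ _
    _ ≤ ε := by linarith

/-- The effect of changing the integrand at the left end of the interval. -/
theorem change_left (h : HasKurzweilIntegralOn G a b I) (hab : a < b)
    (hGH : ∀ s ∈ Ioc a b, ∀ t ∈ Ioc a b, H s t = G s t)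
    (hlim : Tendsto (fun t => H a t - H a a - (G a t - G a a)) (𝓝[>] a) (𝓝 J)) :
    HasKurzweilIntegralOn H a b (I + J) := by
  refine hasKurzweilIntegralOn_iff.2 fun ε hε => ?_
  obtain ⟨δ, hδ, hl⟩ := h.exists_gauge (half_pos hε)
  obtain ⟨c, hc, hJ⟩ := mem_nhdsGT_iff_exists_Ioo_subset.1
    (hlim (Metric.ball_mem_nhds J (half_pos hε)))
  have hc : a < c := hc
  -- The bound `t - a` forces the interval starting at `a` to have tag `a`; the bound `c - a` makes
  -- it end where the limit `J` is already attained up to `ε / 2`.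
  refine ⟨fun t => if t ≤ a then min (δ t) (c - a) else min (δ t) (t - a), ?_, fun l hfl => ?_⟩
  · intro t ht
    by_cases hta : t ≤ a
    · simpa [hta] using ⟨hδ t ht, hc⟩
    · simpa [hta] using ⟨hδ t ht, not_le.1 hta⟩
  have hfl' : IsFineList δ a b l := hfl.mono fun t _ => by
    split_ifs <;> exact min_le_left _ _
  have h1 := hl l hfl'
  cases hfl with
  | nil => exact absurd hab (lt_irrefl _)
  | @cons _ u _ τ l hau hτ hf hfl =>
    obtain rfl : τ = a := by
      by_contra hne
      have hlt : a < τ := lt_of_le_of_ne hτ.1 (Ne.symm hne)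
      have := (hf (show a ∈ Icc a u from ⟨le_rfl, hau.le⟩)).1
      rw [if_neg (not_le.2 hlt)] at this
      linarith [min_le_right (δ τ) (τ - a)]
    have huc : u < c := by
      have := (hf (show u ∈ Icc τ u from ⟨hau.le, le_rfl⟩)).2
      rw [if_pos le_rfl] at this
      linarith [min_le_right (δ τ) (c - τ)]
    have h2 : listSum H l = listSum G l := hfl.listSum_congr fun s hs t ht =>
      hGH s ⟨hau.trans_le hs.1, hs.2⟩ t ⟨hau.trans_le ht.1, ht.2⟩
    have h3 : ‖H τ u - H τ τ - (G τ u - G τ τ) - J‖ < ε / 2 := by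
      simpa [dist_eq_norm] using hJ ⟨hau, huc⟩
    rw [listSum_cons] at h1 ⊢
    rw [h2]
    calc _ = ‖(H τ u - H τ τ - (G τ u - G τ τ) - J)
          + (G τ u - G τ τ + listSum G l - I)‖ := by congr 1; abel
      _ ≤ _ := norm_add_le _ _
      _ < ε := by linarith

end HasKurzweilIntegralOn

/-- A partition which is fine for a gauge that is small away from `b` splits at `b`. -/
theorem IsFineList.split {X : Type*} [NormedAddCommGroup X] {G : ℝ → ℝ → X} {δ : ℝ → ℝ}
    {a b c : ℝ} {l : List (ℝ × ℝ × ℝ)} (h : IsFineList δ a c l)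
    (hδ : ∀ t, t ≠ b → δ t ≤ |t - b|) (hab : a ≤ b) (hbc : b ≤ c) :
    ∃ l₁ l₂, IsFineList δ a b l₁ ∧ IsFineList δ b c l₂ ∧
      listSum G l = listSum G l₁ + listSum G l₂ := by
  induction h with
  | nil a =>
    obtain rfl := le_antisymm hab hbc
    exact ⟨[], [], .nil _, .nil _, by simp⟩
  | @cons a u c τ l hau hτ hf hl ih =>
    rcases hab.eq_or_lt with rfl | hab
    · exact ⟨[], _, .nil _, .cons hau hτ hf hl, by simp⟩
    rcases le_or_gt u b with hub | hbu
    · obtain ⟨l₁, l₂, h1, h2, h3⟩ := ih hub hbc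
      exact ⟨_, l₂, .cons hau hτ hf h1, h2, by simp only [listSum_cons, h3]; abel⟩
    · obtain rfl : τ = b := by
        by_contra hne
        have h1 := hδ τ hne
        have h2 := hf (show b ∈ Icc a u from ⟨hab.le, hbu.le⟩)
        rcases abs_cases (τ - b) with h | h <;> linarith [h2.1, h2.2]
      refine ⟨_, _, .single hab ⟨hab.le, le_rfl⟩ ?_, .cons hbu ⟨le_rfl, hbu.le⟩ ?_ hl, ?_⟩
      · exact (Icc_subset_Icc le_rfl hbu.le).trans hf
      · exact (Icc_subset_Icc hab.le le_rfl).trans hf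
      · simp only [listSum_cons, listSum_nil]; abel

theorem HasKurzweilIntegralOn.concat {X : Type*} [NormedAddCommGroup X] {G : ℝ → ℝ → X}
    {a b c : ℝ} {I J : X} (h : HasKurzweilIntegralOn G a b I)
    (h' : HasKurzweilIntegralOn G b c J) (hab : a ≤ b) (hbc : b ≤ c) :
    HasKurzweilIntegralOn G a c (I + J) := by
  refine hasKurzweilIntegralOn_iff.2 fun ε hε => ?_
  obtain ⟨δ, hδ, hl⟩ := h.exists_gauge (half_pos hε)
  obtain ⟨δ', hδ', hl'⟩ := h'.exists_gauge (half_pos hε)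
  -- The factor `|t - b|` forces every interval containing `b` to be tagged at `b`, so that it can
  -- be cut there. The default values `1` only keep `η` positive.
  set η : ℝ → ℝ := fun t => min (if t ≤ b then δ t else 1)
    (min (if b ≤ t then δ' t else 1) (if t = b then 1 else |t - b|)) with hη
  refine ⟨η, fun t ht => lt_min ?_ (lt_min ?_ ?_), fun l hfl => ?_⟩
  · split_ifs with h1
    exacts [hδ t ⟨ht.1, h1⟩, one_pos]
  · split_ifs with h1
    exacts [hδ' t ⟨h1, ht.2⟩, one_pos]
  · split_ifs with h1
    exacts [one_pos, abs_pos.2 (sub_ne_zero.2 h1)]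
  · obtain ⟨l₁, l₂, h1, h2, h3⟩ := hfl.split (G := G) (b := b) (fun t ht => by
      simp only [hη, if_neg ht]
      exact (min_le_right _ _).trans (min_le_right _ _)) hab hbc
    have h4 := hl l₁ (h1.mono fun t ht => by
      simp only [hη, if_pos ht.2]
      exact min_le_left _ _)
    have h5 := hl' l₂ (h2.mono fun t ht => by
      simp only [hη, if_pos ht.1]
      exact (min_le_right _ _).trans (min_le_left _ _))
    rw [h3]
    calc _ = ‖(listSum G l₁ - I) + (listSum G l₂ - J)‖ := by congr 1; abel
      _ ≤ _ := norm_add_le _ _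
      _ < ε := by linarith

/-! ### Integration against coefficients of controlled variation -/

/-- The increments of `A` are bounded by those of the function `v`. -/
def IsControlledBy {V : Type*} [NormedAddCommGroup V] (A : ℝ → V) (v : ℝ → ℝ) : Prop :=
  ∀ s t, s ≤ t → ‖A t - A s‖ ≤ v t - v s

namespace IsControlledBy

section General

variable {V : Type*} [NormedAddCommGroup V] {A : ℝ → V} {v : ℝ → ℝ}

theorem monotone (h : IsControlledBy A v) : Monotone v := fun s t hst =>
  sub_nonneg.1 ((norm_nonneg _).trans (h s t hst))

theorem neg (h : IsControlledBy A v) : IsControlledBy (fun t => A (-t)) (fun t => -v (-t)) := by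
  intro s t hst
  have := h (-t) (-s) (by linarith)
  rw [norm_sub_rev]
  linarith

/-- The monotone `v` has a right limit, which makes the increments of `A` near `t` small;
completeness does the rest. -/
theorem exists_tendsto_nhdsGT [CompleteSpace V] (h : IsControlledBy A v) (t : ℝ) :
    ∃ R, Tendsto A (𝓝[>] t) (𝓝 R) := by
  refine cauchy_map_iff_exists_tendsto.1 (Metric.cauchy_iff.2 ⟨inferInstance, fun ε hε => ?_⟩)
  have hv := h.monotone.tendsto_rightLim t
  have h1 : ∀ᶠ s in 𝓝[>] t, s ∈ Ioi t ∧ v s < Function.rightLim v t + ε :=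
    (eventually_mem_nhdsWithin).and (hv.eventually (gt_mem_nhds (by linarith)))
  refine ⟨A '' {s | s ∈ Ioi t ∧ v s < Function.rightLim v t + ε}, image_mem_map h1, ?_⟩
  have key : ∀ s ∈ Ioi t, ∀ r, v r < Function.rightLim v t + ε → s ≤ r → dist (A r) (A s) < ε := by
    intro s hs r hr hsr
    rw [dist_eq_norm]
    linarith [h s r hsr, h.monotone.rightLim_le hs]
  rintro _ ⟨s, hs, rfl⟩ _ ⟨r, hr, rfl⟩
  rcases le_total s r with hsr | hsr
  · rw [dist_comm]
    exact key s hs.1 r hr.2 hsr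
  · exact key r hr.1 s hs.2 hsr

/-- Replacing the values on `(-∞, τ]` by the right limit at `τ`. -/
theorem extend_right (h : IsControlledBy A v) {τ : ℝ} {R : V} (hR : Tendsto A (𝓝[>] τ) (𝓝 R)) :
    IsControlledBy (fun t => if t ≤ τ then R else A t)
      (fun t => if t ≤ τ then Function.rightLim v τ else v t) := by
  intro s t hst
  by_cases ht : t ≤ τ
  · simp [ht, hst.trans ht]
  by_cases hs : s ≤ τ
  · simp only [ht, hs, if_true, if_false]
    rw [not_le] at ht
    refine le_of_tendsto_of_tendsto ((tendsto_const_nhds.sub hR).norm)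
      (tendsto_const_nhds.sub (h.monotone.tendsto_rightLim τ)) ?_
    filter_upwards [Ioo_mem_nhdsGT ht] with r hr
    exact h r t hr.2.le
  · simpa only [ht, hs, if_false] using h s t hst

end General

variable {F : Type*} [NormedAddCommGroup F] [NormedSpace ℝ F] {A : ℝ → F →L[ℝ] F} {v : ℝ → ℝ}
  {a b m : ℝ} {f : ℝ → F} {I : F}

theorem norm_listSum_le (h : IsControlledBy A v) {δ : ℝ → ℝ} {l : List (ℝ × ℝ × ℝ)}
    (hl : IsFineList δ a b l) (hf : ∀ t ∈ Icc a b, ‖f t‖ ≤ m) :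
    ‖listSum (fun τ t => A t (f τ)) l‖ ≤ m * (v b - v a) := by
  induction hl with
  | nil => simp
  | @cons a b c τ l hab hτ _ hl ih =>
    have hbc := hl.le
    have h1 := ih fun t ht => hf t ⟨hab.le.trans ht.1, ht.2⟩
    have h2 := hf τ ⟨hτ.1, hτ.2.trans hbc⟩
    have h3 : ‖A b (f τ) - A a (f τ)‖ ≤ (v b - v a) * m := by
      rw [← sub_apply]
      refine (ContinuousLinearMap.le_opNorm _ _).trans (mul_le_mul (h a b hab.le) h2
        (norm_nonneg _) (sub_nonneg.2 (h.monotone hab.le)))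
    rw [listSum_cons]
    refine (norm_add_le _ _).trans ?_
    linarith

theorem norm_integral_le (h : IsControlledBy A v) (hab : a ≤ b)
    (hI : HasKurzweilIntegralOn (fun τ t => A t (f τ)) a b I) (hf : ∀ t ∈ Icc a b, ‖f t‖ ≤ m) :
    ‖I‖ ≤ m * (v b - v a) := by
  have := hI.norm_sub_le_of_forall hab (δ := fun _ => 1) (fun _ _ => one_pos) (x := 0)
    (C := m * (v b - v a)) fun l hl => by
      rw [sub_zero]
      exact h.norm_listSum_le hl hf
  rwa [sub_zero] at this

theorem norm_integral_sub_le (h : IsControlledBy A v) (hab : a ≤ b) {g : ℝ → F} {J : F}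
    (hI : HasKurzweilIntegralOn (fun τ t => A t (f τ)) a b I)
    (hJ : HasKurzweilIntegralOn (fun τ t => A t (g τ)) a b J)
    (hf : ∀ t ∈ Icc a b, ‖f t - g t‖ ≤ m) : ‖I - J‖ ≤ m * (v b - v a) :=
  h.norm_integral_le (f := fun t => f t - g t) hab ((hI.sub hJ).congr (by simp)) hf

/-- Uniform limits commute with the integral. -/
theorem exists_integral_of_tendsto [CompleteSpace F] (h : IsControlledBy A v) (hab : a ≤ b)
    {f : ℕ → ℝ → F} {g : ℝ → F} {I : ℕ → F} {e : ℕ → ℝ} (he : Tendsto e atTop (𝓝 0))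
    (hfg : ∀ n, ∀ t ∈ Icc a b, ‖f n t - g t‖ ≤ e n)
    (hI : ∀ n, HasKurzweilIntegralOn (fun τ t => A t (f n τ)) a b (I n)) :
    ∃ J, Tendsto I atTop (𝓝 J) ∧ HasKurzweilIntegralOn (fun τ t => A t (g τ)) a b J := by
  have hlim : Tendsto (fun n => e n * (v b - v a)) atTop (𝓝 0) := by
    simpa using he.mul_const (v b - v a)
  have hsmall : ∀ ε > 0, ∃ N, ∀ n ≥ N, e n * (v b - v a) < ε := fun ε hε =>
    eventually_atTop.1 (hlim.eventually (gt_mem_nhds hε))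
  have hcau : CauchySeq I := by
    refine Metric.cauchySeq_iff.2 fun ε hε => ?_
    obtain ⟨N, hN⟩ := hsmall (ε / 2) (half_pos hε)
    refine ⟨N, fun n hn k hk => ?_⟩
    have h1 := h.norm_integral_sub_le (m := e n + e k) hab (hI n) (hI k) fun t ht => by
      calc ‖f n t - f k t‖ = ‖(f n t - g t) - (f k t - g t)‖ := by congr 1; abel
        _ ≤ _ := norm_sub_le _ _
        _ ≤ _ := add_le_add (hfg n t ht) (hfg k t ht)
    rw [dist_eq_norm]
    linarith [hN n hn, hN k hk]
  obtain ⟨J, hJ⟩ := cauchySeq_tendsto_of_complete hcau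
  refine ⟨J, hJ, hasKurzweilIntegralOn_iff.2 fun ε hε => ?_⟩
  obtain ⟨N, hN⟩ := hsmall (ε / 3) (by positivity)
  obtain ⟨n, hn, hnN⟩ := ((Metric.tendsto_nhds.1 hJ (ε / 3) (by positivity)).and
    (eventually_ge_atTop N)).exists
  obtain ⟨δ, hδ, hl⟩ := (hI n).exists_gauge (show 0 < ε / 3 by positivity)
  refine ⟨δ, hδ, fun l hfl => ?_⟩
  have h1 := h.norm_listSum_le (f := fun t => f n t - g t) hfl (hfg n)
  simp only [map_sub] at h1
  rw [listSum_sub (fun τ t => A t (f n τ)) (fun τ t => A t (g τ))] at h1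
  have h2 := hl l hfl
  rw [dist_eq_norm] at hn
  set S := listSum (fun τ t => A t (g τ)) l
  set S' := listSum (fun τ t => A t (f n τ)) l
  calc ‖S - J‖ = ‖(S' - I n) + (I n - J) - (S' - S)‖ := by congr 1; abel
    _ ≤ ‖(S' - I n) + (I n - J)‖ + ‖S' - S‖ := norm_sub_le _ _
    _ ≤ ‖S' - I n‖ + ‖I n - J‖ + ‖S' - S‖ := by gcongr; exact norm_add_le _ _
    _ < ε := by linarith [hN n hnN]

/-- A constant integrand telescopes; altering its value at `a` changes the integral by a jump term,
given by the right limit of `A`. -/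
theorem exists_integral_of_const_on_Ioc [CompleteSpace F] (h : IsControlledBy A v) (hab : a < b)
    (hf : ∀ t ∈ Ioc a b, f t = f b) :
    ∃ I, HasKurzweilIntegralOn (fun τ t => A t (f τ)) a b I := by
  obtain ⟨R, hR⟩ := h.exists_tendsto_nhdsGT a
  have key : ∀ x, Tendsto (fun t => A t x) (𝓝[>] a) (𝓝 (R x)) := fun x =>
    ((ContinuousLinearMap.apply ℝ F x).continuous.tendsto R).comp hR
  refine ⟨_, (HasKurzweilIntegralOn.of_forall_eq (fun t => A t (f b)) a b).change_left hab
    (fun s hs t _ => by rw [hf s hs])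
    (((key (f a)).sub_const _).sub ((key (f b)).sub_const _))⟩

theorem exists_integral_of_const_on_Ico [CompleteSpace F] (h : IsControlledBy A v) (hab : a < b)
    (hf : ∀ t ∈ Ico a b, f t = f a) :
    ∃ I, HasKurzweilIntegralOn (fun τ t => A t (f τ)) a b I := by
  obtain ⟨I, hI⟩ := h.neg.exists_integral_of_const_on_Ioc (f := fun t => f (-t)) (neg_lt_neg hab)
    (fun t ht => by rw [neg_neg]; exact hf _ ⟨by linarith [ht.2], by linarith [ht.1]⟩)
  exact ⟨-I, by simpa using hI.neg⟩

theorem eventually_sub_rightLim_le (h : IsControlledBy A v) (t : ℝ) {ε : ℝ} (hε : 0 < ε) :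
    ∀ᶠ s in 𝓝[>] t, v s - Function.rightLim v t ≤ ε := by
  filter_upwards [(h.monotone.tendsto_rightLim t).eventually
    (gt_mem_nhds (show Function.rightLim v t < Function.rightLim v t + ε by linarith))] with s hs
  linarith

theorem eventually_leftLim_sub_le (h : IsControlledBy A v) (t : ℝ) {ε : ℝ} (hε : 0 < ε) :
    ∀ᶠ s in 𝓝[<] t, Function.leftLim v t - v s ≤ ε := by
  filter_upwards [(h.monotone.tendsto_leftLim t).eventually
    (lt_mem_nhds (show Function.leftLim v t - ε < Function.leftLim v t by linarith))] with s hs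
  linarith

/-- Functions whose variation is controlled by `v` are integrable. -/
theorem exists_integral [CompleteSpace F] (h : IsControlledBy A v) (hab : a ≤ b) {C : ℝ}
    (hC : 0 ≤ C) (hf : ∀ s t, a ≤ s → s ≤ t → t ≤ b → ‖f t - f s‖ ≤ C * (v t - v s)) :
    ∃ I, HasKurzweilIntegralOn (fun τ t => A t (f τ)) a b I := by
  -- Uniform approximation by integrable functions, locally constant up to a value at one endpoint.
  -- Agreement with `f` at both ends is what lets adjacent pieces be glued.
  have key : ∀ ε > 0, ∃ (g : ℝ → F) (I : F), (∀ t ∈ Icc a b, ‖g t - f t‖ ≤ ε) ∧ g a = f a ∧ g b = f b ∧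
      HasKurzweilIntegralOn (fun τ t => A t (g τ)) a b I := by
    intro ε hε
    -- Dividing by `C + 1` covers the case `C = 0`.
    have hε' : 0 < ε / (C + 1) := by positivity
    have hmul : ∀ x ≤ ε / (C + 1), C * x ≤ ε := fun x hx => by
      have h1 := mul_le_mul_of_nonneg_left hx hC
      have h2 : (C + 1) * (ε / (C + 1)) = ε := by field_simp
      linarith
    refine cousin_induction (P := fun r s => ∃ (g : ℝ → F) (I : F), (∀ t ∈ Icc r s, ‖g t - f t‖ ≤ ε) ∧
      g r = f r ∧ g s = f s ∧ HasKurzweilIntegralOn (fun τ t => A t (g τ)) r s I) hab ?_ ?_ ?_ ?_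
    · exact fun t => ⟨f, 0, by simp [hε.le], rfl, rfl, .refl _ _⟩
    · rintro r s t _ hrs hst _ ⟨g, I, hg, hgr, hgs, hI⟩ ⟨g', I', hg', hgs', hgt', hI'⟩
      have e1 : ∀ q ∈ Icc r s, (if q ≤ s then g q else g' q) = g q := fun q hq => if_pos hq.2
      have e2 : ∀ q ∈ Icc s t, (if q ≤ s then g q else g' q) = g' q := fun q hq => by
        split_ifs with hqs
        · rw [le_antisymm hqs hq.1, hgs, hgs']
        · rfl
      refine ⟨fun q => if q ≤ s then g q else g' q, I + I', fun q hq => ?_, ?_, ?_,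
        (hI.congr fun q hq _ _ => ?_).concat (hI'.congr fun q hq _ _ => ?_) hrs hst⟩
      · rcases le_total q s with hqs | hqs
        · simpa only [e1 q ⟨hq.1, hqs⟩] using hg q ⟨hq.1, hqs⟩
        · simpa only [e2 q ⟨hqs, hq.2⟩] using hg' q ⟨hqs, hq.2⟩
      · exact (e1 r ⟨le_rfl, hrs⟩).trans hgr
      · exact (e2 t ⟨hst, le_rfl⟩).trans hgt'
      · simp only [e1 q hq]
      · simp only [e2 q hq]
    · intro t ht
      filter_upwards [h.eventually_sub_rightLim_le t hε', self_mem_nhdsWithin] with s hs hts hsb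
      have hts : t < s := hts
      obtain ⟨I, hI⟩ := h.exists_integral_of_const_on_Ioc
        (f := fun q => if q ≤ t then f t else f s) hts fun q hq => by
          simp [not_le.2 hq.1, not_le.2 hts]
      refine ⟨_, I, fun q hq => ?_, by simp, by simp [not_le.2 hts], hI⟩
      rcases hq.1.eq_or_lt with rfl | hq1
      · simp [hε.le]
      · simp only [not_le.2 hq1, if_false]
        refine (hf q s (ht.1.trans hq.1) hq.2 hsb).trans (hmul _ ?_)
        linarith [h.monotone.rightLim_le hq1]
    · intro t ht
      filter_upwards [h.eventually_leftLim_sub_le t hε', self_mem_nhdsWithin] with s hs hts hsb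
      have hts : s < t := hts
      obtain ⟨I, hI⟩ := h.exists_integral_of_const_on_Ico
        (f := fun q => if q < t then f s else f t) hts fun q hq => by
          simp [hq.2, hts]
      refine ⟨_, I, fun q hq => ?_, by simp [hts], by simp, hI⟩
      rcases hq.2.eq_or_lt with rfl | hq1
      · simp [hε.le]
      · simp only [hq1, if_true]
        rw [norm_sub_rev]
        refine (hf s q hsb hq.1 (hq1.le.trans ht.2)).trans (hmul _ ?_)
        linarith [h.monotone.le_leftLim hq1]
  choose! g I hg _ _ hI using key
  have hpos : ∀ n : ℕ, (0 : ℝ) < 1 / ((n : ℝ) + 1) := fun n => by positivity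
  obtain ⟨J, -, hJ⟩ := h.exists_integral_of_tendsto hab tendsto_one_div_add_atTop_nhds_zero_nat
    (fun n => hg _ (hpos n)) (fun n => hI _ (hpos n))
  exact ⟨J, hJ⟩

end IsControlledBy

/-! ### Solutions on compact intervals and on the line -/

section Solutions

variable {F : Type*} [NormedAddCommGroup F] [NormedSpace ℝ F] {A B : ℝ → F →L[ℝ] F}
  {v w : ℝ → ℝ} {a b c : ℝ} {x y : ℝ → F}

/-- `x` solves the linear equation on `[a, b]`. -/
def IsSolOn (A : ℝ → F →L[ℝ] F) (a b : ℝ) (x : ℝ → F) : Prop :=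
  ∀ c d, a ≤ c → c ≤ d → d ≤ b → HasKurzweilIntegralOn (fun τ t => A t (x τ)) c d (x d - x c)

namespace IsSolOn

theorem of_left (h : ∀ t ∈ Icc a b, HasKurzweilIntegralOn (fun τ t => A t (x τ)) a t (x t - x a)) :
    IsSolOn A a b x := fun c d hac hcd hdb => by
  have := (h d ⟨hac.trans hcd, hdb⟩).sub_left (h c ⟨hac, hcd.trans hdb⟩) hac hcd
  rwa [sub_sub_sub_cancel_right] at this

theorem refl (A : ℝ → F →L[ℝ] F) (a : ℝ) (x : ℝ → F) : IsSolOn A a a x := fun c d hac hcd hdb => by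
  obtain rfl : d = c := le_antisymm (hdb.trans hac) hcd
  rw [sub_self]
  exact .refl _ _

theorem mono (h : IsSolOn A a b x) {c d : ℝ} (hac : a ≤ c) (hdb : d ≤ b) : IsSolOn A c d x :=
  fun _ _ hc hcd hd => h _ _ (hac.trans hc) hcd (hd.trans hdb)

theorem congr (h : IsSolOn A a b x) (hAB : ∀ t ∈ Icc a b, A t = B t)
    (hxy : ∀ t ∈ Icc a b, x t = y t) : IsSolOn B a b y := fun c d hac hcd hdb => by
  rw [← hxy c ⟨hac, hcd.trans hdb⟩, ← hxy d ⟨hac.trans hcd, hdb⟩]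
  refine (h c d hac hcd hdb).congr fun s hs t ht => ?_
  rw [hxy s ⟨hac.trans hs.1, hs.2.trans hdb⟩, hAB t ⟨hac.trans ht.1, ht.2.trans hdb⟩]

theorem neg (h : IsSolOn A a b x) :
    IsSolOn (fun t => A (-t)) (-b) (-a) (fun t => x (-t)) := fun c d hac hcd hdb => by
  have := (h (-d) (-c) (by linarith) (by linarith) (by linarith)).neg
  rwa [neg_neg, neg_neg, neg_sub] at this

theorem sub (hx : IsSolOn A a b x) (hy : IsSolOn A a b y) :
    IsSolOn A a b (fun t => x t - y t) := fun c d hac hcd hdb => by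
  have := (hx c d hac hcd hdb).sub (hy c d hac hcd hdb)
  rw [sub_sub_sub_comm] at this
  exact this.congr (by simp)

theorem concat (hx : IsSolOn A a b x) (hy : IsSolOn A b c y) (hxy : x b = y b) (hab : a ≤ b) :
    ∃ z, IsSolOn A a c z ∧ (∀ t ∈ Icc a b, z t = x t) ∧ ∀ t ∈ Icc b c, z t = y t := by
  have e1 : ∀ t ∈ Icc a b, (if t ≤ b then x t else y t) = x t := fun t ht => if_pos ht.2
  have e2 : ∀ t ∈ Icc b c, (if t ≤ b then x t else y t) = y t := fun t ht => by
    split_ifs with h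
    · rw [le_antisymm h ht.1, hxy]
    · rfl
  refine ⟨fun t => if t ≤ b then x t else y t, of_left fun t ht => ?_, e1, e2⟩
  have hx' := hx.congr (fun _ _ => rfl) fun t ht => (e1 t ht).symm
  have hy' := hy.congr (fun _ _ => rfl) fun t ht => (e2 t ht).symm
  rcases le_total t b with htb | hbt
  · exact hx' a t le_rfl ht.1 htb
  · have := (hx' a b le_rfl hab le_rfl).concat (hy' b t le_rfl hbt ht.2) hab hbt
    rwa [add_comm, sub_add_sub_cancel] at this

/-- Replacing the coefficient and the solution at the left end of the interval. -/
theorem change_left (hy : IsSolOn B a b y) (hAB : ∀ t ∈ Ioc a b, A t = B t)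
    (hxy : ∀ t ∈ Ioc a b, x t = y t) {R : F →L[ℝ] F} (hA : Tendsto A (𝓝[>] a) (𝓝 R))
    (hB : Tendsto B (𝓝[>] a) (𝓝 R))
    (h : x a + (R - A a) (x a) = y a + (R - B a) (y a)) : IsSolOn A a b x := by
  refine of_left fun t ht => ?_
  rcases ht.1.eq_or_lt with rfl | hat
  · rw [sub_self]
    exact .refl _ _
  have key : ∀ {A : ℝ → F →L[ℝ] F}, Tendsto A (𝓝[>] a) (𝓝 R) → ∀ x,
      Tendsto (fun t => A t x) (𝓝[>] a) (𝓝 (R x)) := fun hA x =>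
    ((ContinuousLinearMap.apply ℝ F x).continuous.tendsto R).comp hA
  have h1 := (hy a t le_rfl hat.le ht.2).change_left (H := fun τ t => A t (x τ)) hat
    (fun s hs r hr => by
      rw [hAB r ⟨hr.1, hr.2.trans ht.2⟩, hxy s ⟨hs.1, hs.2.trans ht.2⟩])
    (((key hA (x a)).sub_const _).sub ((key hB (y a)).sub_const _))
  convert h1 using 1
  rw [hxy t ⟨hat, ht.2⟩]
  simp only [sub_apply] at h
  rw [eq_comm, ← sub_eq_zero]
  rw [← sub_eq_zero] at h
  rw [← h]
  abel

/-- Boundedness is not part of the notion of solution; it comes from `x t ≈ x a + (A t - A a) (x a)`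
near `a`, with error at most `1`. -/
theorem eventually_norm_le (hx : IsSolOn A a b x) (hA : IsControlledBy A v) (hab : a < b) :
    ∃ m, ∀ᶠ t in 𝓝[>] a, t ≤ b → ‖x t‖ ≤ m := by
  refine ⟨1 + ‖x a‖ + (v b - v a) * ‖x a‖, ?_⟩
  filter_upwards [HasKurzweilIntegralOn.eventually_norm_sub_le hab
    (fun t ht => hx t b ht.1 ht.2 le_rfl) one_pos, self_mem_nhdsWithin] with t h1 hat htb
  have hat : a < t := hat
  have h2 := h1 htb
  have h3 : ‖A t (x a) - A a (x a)‖ ≤ (v b - v a) * ‖x a‖ := by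
    rw [← sub_apply]
    refine (ContinuousLinearMap.le_opNorm _ _).trans
      (mul_le_mul_of_nonneg_right ?_ (norm_nonneg _))
    linarith [hA a t hat.le, hA.monotone htb]
  calc ‖x t‖ = ‖(x t - x a - (A t (x a) - A a (x a))) + x a + (A t (x a) - A a (x a))‖ := by
        congr 1; abel
    _ ≤ _ := norm_add₃_le
    _ ≤ _ := by gcongr

/-- On an interval of small variation a bounded solution with a zero vanishes. -/
theorem eq_zero_of_small (hx : IsSolOn A a b x) (hA : IsControlledBy A v)
    (hv : v b - v a ≤ 1 / 2) {m : ℝ} (hm : ∀ t ∈ Icc a b, ‖x t‖ ≤ m) (hc : c ∈ Icc a b)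
    (hxc : x c = 0) : ∀ t ∈ Icc a b, x t = 0 := by
  have hm0 : 0 ≤ m := (norm_nonneg _).trans (hm c hc)
  -- As `x c = 0`, the value `x t` is up to sign the integral between `c` and `t`, which is at most
  -- `m` times a variation of at most `1/2`.
  have step : ∀ m, 0 ≤ m → (∀ t ∈ Icc a b, ‖x t‖ ≤ m) → ∀ t ∈ Icc a b, ‖x t‖ ≤ m / 2 := by
    intro m hm0 hm t ht
    have key : ∀ r ∈ Icc a b, ∀ s ∈ Icc a b, r ≤ s → ‖x s - x r‖ ≤ m / 2 := by
      intro r hr s hs hrs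
      refine (hA.norm_integral_le hrs (hx r s hr.1 hrs hs.2) fun t ht =>
        hm t ⟨hr.1.trans ht.1, ht.2.trans hs.2⟩).trans ?_
      have := mul_le_mul_of_nonneg_left (show v s - v r ≤ 1 / 2 by
        linarith [hA.monotone hr.1, hA.monotone hs.2]) hm0
      linarith
    rcases le_total t c with h | h
    · simpa [hxc] using key t ht c hc h
    · simpa [hxc] using key c hc t ht h
  have all : ∀ n : ℕ, ∀ t ∈ Icc a b, ‖x t‖ ≤ m / 2 ^ n := by
    intro n
    induction n with
    | zero => simpa using hm
    | succ n ih =>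
      rw [pow_succ, ← div_div]
      exact step _ (by positivity) ih
  intro t ht
  have hlim : Tendsto (fun n : ℕ => m / 2 ^ n) atTop (𝓝 0) := by
    simpa [div_eq_mul_inv] using
      (tendsto_pow_atTop_nhds_zero_of_lt_one (r := (2⁻¹ : ℝ)) (by norm_num)
        (by norm_num)).const_mul m
  exact norm_le_zero_iff.1 (ge_of_tendsto' hlim fun n => all n t ht)

end IsSolOn

/-- The Picard step. -/
theorem IsControlledBy.exists_picard_step [CompleteSpace F] (hA : IsControlledBy A v)
    (c : ℝ) (x₀ : F) {C : ℝ} {f : ℝ → F}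
    (hf : ∀ s t, a ≤ s → s ≤ t → t ≤ b → ‖f t - f s‖ ≤ C * (v t - v s)) :
    ∃ g : ℝ → F, (∃ C, ∀ s t, a ≤ s → s ≤ t → t ≤ b → ‖g t - g s‖ ≤ C * (v t - v s)) ∧
      g c = x₀ ∧ ∀ s t, a ≤ s → s ≤ t → t ≤ b →
        HasKurzweilIntegralOn (fun τ t => A t (f τ)) s t (g t - g s) := by
  have hf' : ∀ s t, a ≤ s → s ≤ t → t ≤ b → ‖f t - f s‖ ≤ |C| * (v t - v s) :=
    fun s t hs hst ht => (hf s t hs hst ht).trans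
      (mul_le_mul_of_nonneg_right (le_abs_self C) (sub_nonneg.2 (hA.monotone hst)))
  have hJ : ∀ t ∈ Icc a b, ∃ J, HasKurzweilIntegralOn (fun τ t => A t (f τ)) a t J := fun t ht =>
    hA.exists_integral ht.1 (abs_nonneg C) fun s r hs hsr hr => hf' s r hs hsr (hr.trans ht.2)
  choose! J hJ using hJ
  have hI : ∀ s t, a ≤ s → s ≤ t → t ≤ b →
      HasKurzweilIntegralOn (fun τ t => A t (f τ)) s t (J t - J s) := fun s t hs hst ht =>
    (hJ t ⟨hs.trans hst, ht⟩).sub_left (hJ s ⟨hs, hst.trans ht⟩) hs hst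
  have hb : ∀ t ∈ Icc a b, ‖f t‖ ≤ ‖f a‖ + |C| * (v b - v a) := fun t ht => by
    have h1 := hf' a t le_rfl ht.1 ht.2
    have h2 := mul_le_mul_of_nonneg_left
      (show v t - v a ≤ v b - v a by linarith [hA.monotone ht.2]) (abs_nonneg C)
    have h3 := norm_le_norm_add_norm_sub' (f t) (f a)
    linarith
  refine ⟨fun t => x₀ + (J t - J c), ⟨‖f a‖ + |C| * (v b - v a), fun s t hs hst ht => ?_⟩,
    by simp, fun s t hs hst ht => ?_⟩
  · rw [add_sub_add_left_eq_sub, sub_sub_sub_cancel_right]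
    exact hA.norm_integral_le hst (hI s t hs hst ht) fun r hr =>
      hb r ⟨hs.trans hr.1, hr.2.trans ht⟩
  · rw [add_sub_add_left_eq_sub, sub_sub_sub_cancel_right]
    exact hI s t hs hst ht

/-- Existence of solutions on intervals of small variation. -/
theorem IsControlledBy.exists_isSolOn_of_small [CompleteSpace F] (hA : IsControlledBy A v)
    (hv : v b - v a ≤ 1 / 2) (hc : c ∈ Icc a b) (x₀ : F) : ∃ x, IsSolOn A a b x ∧ x c = x₀ := by
  -- The iterates live in the class of functions controlled by `v`: its members are integrable and a
  -- Picard step stays in it.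
  let S := {f : ℝ → F // ∃ C, ∀ s t, a ≤ s → s ≤ t → t ≤ b → ‖f t - f s‖ ≤ C * (v t - v s)}
  have hstep : ∀ f : S, ∃ g : S, g.1 c = x₀ ∧ ∀ s t, a ≤ s → s ≤ t → t ≤ b →
      HasKurzweilIntegralOn (fun τ t => A t (f.1 τ)) s t (g.1 t - g.1 s) := fun ⟨f, C, hf⟩ => by
    obtain ⟨g, hg, hg'⟩ := hA.exists_picard_step c x₀ hf
    exact ⟨⟨g, hg⟩, hg'⟩
  choose T hTc hT using hstep
  let X : ℕ → S := fun n => T^[n] ⟨fun _ => x₀, 0, by simp⟩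
  have hX : ∀ n, X (n + 1) = T (X n) := fun n => Function.iterate_succ_apply' _ _ _
  have hXc : ∀ n, (X n).1 c = x₀ := by
    rintro (_ | n)
    · rfl
    · rw [hX, hTc]
  have hXI : ∀ n s t, a ≤ s → s ≤ t → t ≤ b →
      HasKurzweilIntegralOn (fun τ t => A t ((X n).1 τ)) s t ((X (n + 1)).1 t - (X (n + 1)).1 s) :=
    fun n => by rw [hX]; exact hT (X n)
  obtain ⟨K, hK⟩ : ∃ K, ∀ t ∈ Icc a b, ‖(X 1).1 t - (X 0).1 t‖ ≤ K := by
    have h0 : ∀ t ∈ Icc a b, ‖(X 0).1 t‖ ≤ ‖x₀‖ := fun _ _ => le_rfl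
    refine ⟨‖(X 1).1 a‖ + ‖x₀‖ * (v b - v a) + ‖x₀‖, fun t ht => ?_⟩
    have h1 := hA.norm_integral_le ht.1 (hXI 0 a t le_rfl ht.1 ht.2) fun r hr =>
      h0 r ⟨hr.1, hr.2.trans ht.2⟩
    have h2 := mul_le_mul_of_nonneg_left
      (show v t - v a ≤ v b - v a by linarith [hA.monotone ht.2]) (norm_nonneg x₀)
    have h3 := norm_le_norm_add_norm_sub' ((X 1).1 t) ((X 1).1 a)
    have h4 := norm_sub_le ((X 1).1 t) ((X 0).1 t)
    linarith [h0 t ht]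
  have hdiff : ∀ n : ℕ, ∀ t ∈ Icc a b, ‖(X (n + 1)).1 t - (X n).1 t‖ ≤ K / 2 ^ n := by
    intro n
    induction n with
    | zero => simpa using hK
    | succ n ih =>
      have key : ∀ r ∈ Icc a b, ∀ s ∈ Icc a b, r ≤ s →
          ‖((X (n + 2)).1 s - (X (n + 2)).1 r) - ((X (n + 1)).1 s - (X (n + 1)).1 r)‖ ≤
            K / 2 ^ (n + 1) := by
        intro r hr s hs hrs
        refine (hA.norm_integral_sub_le hrs (hXI (n + 1) r s hr.1 hrs hs.2)
          (hXI n r s hr.1 hrs hs.2) fun t ht => ih t ⟨hr.1.trans ht.1, ht.2.trans hs.2⟩).trans ?_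
        have := mul_le_mul_of_nonneg_left (show v s - v r ≤ 1 / 2 by
          linarith [hA.monotone hr.1, hA.monotone hs.2]) ((norm_nonneg _).trans (ih r hr))
        rw [pow_succ, ← div_div]
        linarith
      intro t ht
      rcases le_total t c with h | h
      · have := key t ht c hc h
        rw [hXc, hXc, sub_sub_sub_cancel_left, norm_sub_rev] at this
        exact this
      · have := key c hc t ht h
        rw [hXc, hXc, sub_sub_sub_cancel_right] at this
        exact this
  -- The bound is `K / 2 ^ n`, in the shape that `cauchySeq_of_le_geometric_two` expects.
  have hdist : ∀ t ∈ Icc a b, ∀ n, dist ((X n).1 t) ((X (n + 1)).1 t) ≤ 2 * K / 2 / 2 ^ n :=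
    fun t ht n => by
      rw [dist_comm, dist_eq_norm, mul_div_cancel_left₀ K two_ne_zero]
      exact hdiff n t ht
  have hlim : ∀ t ∈ Icc a b, ∃ y, Tendsto (fun n => (X n).1 t) atTop (𝓝 y) := fun t ht =>
    cauchySeq_tendsto_of_complete (cauchySeq_of_le_geometric_two (hdist t ht))
  choose! x hx using hlim
  refine ⟨x, fun s t hs hst ht => ?_, tendsto_nhds_unique (hx c hc) (by simp [hXc])⟩
  have he : Tendsto (fun n : ℕ => 2 * K / 2 ^ n) atTop (𝓝 0) := by
    simpa [div_eq_mul_inv] using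
      (tendsto_pow_atTop_nhds_zero_of_lt_one (r := (2⁻¹ : ℝ)) (by norm_num)
        (by norm_num)).const_mul (2 * K)
  obtain ⟨J, hJ, hJ'⟩ := hA.exists_integral_of_tendsto hst he (g := x) (fun n r hr => by
    have hr' : r ∈ Icc a b := ⟨hs.trans hr.1, hr.2.trans ht⟩
    rw [← dist_eq_norm]
    exact dist_le_of_le_geometric_two_of_tendsto (hdist r hr') (hx r hr') n)
    (fun n => hXI n s t hs hst ht)
  have h1 := ((hx t ⟨hs.trans hst, ht⟩).comp (tendsto_add_atTop_nat 1)).sub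
    ((hx s ⟨hs, hst.trans ht⟩).comp (tendsto_add_atTop_nat 1))
  rwa [tendsto_nhds_unique hJ h1] at hJ'

/-- The assumptions of the existence and uniqueness theorem on the whole line. -/
structure IsRegular (A : ℝ → F →L[ℝ] F) (v : ℝ → ℝ) : Prop where
  isControlledBy : IsControlledBy A v
  isUnit_left : ∀ t L, Tendsto A (𝓝[<] t) (𝓝 L) → IsUnit (1 - (A t - L))
  isUnit_right : ∀ t R, Tendsto A (𝓝[>] t) (𝓝 R) → IsUnit (1 + (R - A t))

namespace IsRegular

theorem neg (h : IsRegular A v) : IsRegular (fun t => A (-t)) (fun t => -v (-t)) where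
  isControlledBy := h.isControlledBy.neg
  isUnit_left t L hL := by
    have h1 : Tendsto A (𝓝[>] (-t)) (𝓝 L) := by
      simpa [Function.comp_def] using hL.comp tendsto_neg_nhdsGT_neg
    convert h.isUnit_right _ L h1 using 1
    abel
  isUnit_right t R hR := by
    have h1 : Tendsto A (𝓝[<] (-t)) (𝓝 R) := by
      simpa [Function.comp_def] using hR.comp tendsto_neg_nhdsLT_neg
    convert h.isUnit_left _ R h1 using 1
    abel

theorem exists_inverse (h : IsRegular A v) {R : F →L[ℝ] F} (hR : Tendsto A (𝓝[>] a) (𝓝 R)) :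
    ∃ S : F →L[ℝ] F, (∀ x, S (x + (R - A a) x) = x) ∧ ∀ x, S x + (R - A a) (S x) = x := by
  obtain ⟨u, hu⟩ := h.isUnit_right a R hR
  have e : ∀ x, x + (R - A a) x = (u : F →L[ℝ] F) x := fun x => by rw [hu]; rfl
  refine ⟨(↑u⁻¹ : F →L[ℝ] F), fun x => ?_, fun x => ?_⟩
  · rw [e, ← mul_apply_eq_comp, Units.inv_mul]; rfl
  · rw [e, ← mul_apply_eq_comp, Units.mul_inv]; rfl

theorem tendsto_extend {R : F →L[ℝ] F} (hR : Tendsto A (𝓝[>] a) (𝓝 R)) :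
    Tendsto (fun t => if t ≤ a then R else A t) (𝓝[>] a) (𝓝 R) := by
  refine hR.congr' ?_
  filter_upwards [self_mem_nhdsWithin] with t ht
  rw [if_neg (not_le.2 ht)]

/-- With `A a` replaced by `R = A(a⁺)`, the variation on `[a, b]` is `v b - v(a⁺)`, which is small
for `b` near `a`. A solution `y` of the modified equation becomes one of the original after changing
its value at `a` to the `x₁` with `x₁ + (R - A a) x₁ = y a`. -/
theorem eventually_exists_right [CompleteSpace F] (h : IsRegular A v) (a : ℝ) :
    ∀ᶠ b in 𝓝[>] a, (∀ x₀, ∃ x, IsSolOn A a b x ∧ x a = x₀) ∧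
      ∀ x₀, ∃ x, IsSolOn A a b x ∧ x b = x₀ := by
  obtain ⟨R, hR⟩ := h.isControlledBy.exists_tendsto_nhdsGT a
  obtain ⟨S, hS, hS'⟩ := h.exists_inverse hR
  filter_upwards [h.isControlledBy.eventually_sub_rightLim_le a one_half_pos,
    self_mem_nhdsWithin] with b hb hab
  have hab : a < b := hab
  have hsmall := fun {c : ℝ} (hc : c ∈ Icc a b) (x₀ : F) =>
    (h.isControlledBy.extend_right hR).exists_isSolOn_of_small (a := a) (b := b)
      (by simpa [not_le.2 hab] using hb) hc x₀
  have key : ∀ (y : ℝ → F), IsSolOn (fun t => if t ≤ a then R else A t) a b y → ∀ x₁,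
      x₁ + (R - A a) x₁ = y a → IsSolOn A a b (fun t => if t ≤ a then x₁ else y t) := by
    intro y hy x₁ hx₁
    refine hy.change_left (fun t ht => by simp [not_le.2 ht.1])
      (fun t ht => by simp [not_le.2 ht.1]) hR (tendsto_extend hR) ?_
    simpa using hx₁
  constructor
  · intro x₀
    obtain ⟨y, hy, hya⟩ := hsmall ⟨le_rfl, hab.le⟩ (x₀ + (R - A a) x₀)
    exact ⟨_, key y hy x₀ hya.symm, by simp⟩
  · intro x₀
    obtain ⟨y, hy, hyb⟩ := hsmall ⟨hab.le, le_rfl⟩ x₀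
    exact ⟨_, key y hy (S (y a)) (hS' _), by simp [not_le.2 hab, hyb]⟩

theorem eventually_exists_left [CompleteSpace F] (h : IsRegular A v) (b : ℝ) :
    ∀ᶠ a in 𝓝[<] b, (∀ x₀, ∃ x, IsSolOn A a b x ∧ x a = x₀) ∧
      ∀ x₀, ∃ x, IsSolOn A a b x ∧ x b = x₀ := by
  filter_upwards [(tendsto_neg_nhdsLT (a := b)).eventually (h.neg.eventually_exists_right (-b))]
    with a ha
  refine ⟨fun x₀ => ?_, fun x₀ => ?_⟩
  · obtain ⟨x, hx, hxa⟩ := ha.2 x₀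
    exact ⟨_, by simpa using hx.neg, by simpa using hxa⟩
  · obtain ⟨x, hx, hxa⟩ := ha.1 x₀
    exact ⟨_, by simpa using hx.neg, by simpa using hxa⟩

/-- Existence of solutions with given value at either end of a compact interval. -/
theorem exists_isSolOn [CompleteSpace F] (h : IsRegular A v) (hab : a ≤ b) :
    (∀ x₀, ∃ x, IsSolOn A a b x ∧ x a = x₀) ∧ ∀ x₀, ∃ x, IsSolOn A a b x ∧ x b = x₀ := by
  refine cousin_induction (P := fun a b => (∀ x₀, ∃ x, IsSolOn A a b x ∧ x a = x₀) ∧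
    ∀ x₀, ∃ x, IsSolOn A a b x ∧ x b = x₀) hab ?_ ?_ ?_ ?_
  · exact fun t => ⟨fun x₀ => ⟨fun _ => x₀, .refl _ _ _, rfl⟩,
      fun x₀ => ⟨fun _ => x₀, .refl _ _ _, rfl⟩⟩
  · rintro r s t _ hrs hst _ ⟨h1, h2⟩ ⟨h3, h4⟩
    constructor
    · intro x₀
      obtain ⟨x, hx, hxr⟩ := h1 x₀
      obtain ⟨y, hy, hys⟩ := h3 (x s)
      obtain ⟨z, hz, hzx, -⟩ := hx.concat hy hys.symm hrs
      exact ⟨z, hz, by rw [hzx r ⟨le_rfl, hrs⟩, hxr]⟩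
    · intro x₀
      obtain ⟨y, hy, hyt⟩ := h4 x₀
      obtain ⟨x, hx, hxs⟩ := h2 (y s)
      obtain ⟨z, hz, -, hzy⟩ := hx.concat hy hxs hrs
      exact ⟨z, hz, by rw [hzy t ⟨hst, le_rfl⟩, hyt]⟩
  · intro t _
    filter_upwards [h.eventually_exists_right t] with s hs _ using hs
  · intro t _
    filter_upwards [h.eventually_exists_left t] with s hs _ using hs

/-- The same jump removal turns `x` into a bounded solution `y` of an equation of small variation,
where one zero spreads everywhere; `I + Δ⁺A(a)` is injective, so `y a = 0` iff `x a = 0`. -/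
theorem eventually_eq_zero_iff_right [CompleteSpace F] (h : IsRegular A v) (hx : IsSolOn A a b x)
    (hab : a < b) : ∀ᶠ t in 𝓝[>] a, t ≤ b → (x a = 0 ↔ x t = 0) := by
  obtain ⟨R, hR⟩ := h.isControlledBy.exists_tendsto_nhdsGT a
  obtain ⟨S, hS, -⟩ := h.exists_inverse hR
  obtain ⟨m, hm⟩ := hx.eventually_norm_le h.isControlledBy hab
  obtain ⟨δ, hδ, hm⟩ := eventually_nhdsGT_iff_exists.1 hm
  filter_upwards [h.isControlledBy.eventually_sub_rightLim_le a one_half_pos,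
    self_mem_nhdsWithin, Ioo_mem_nhdsGT (lt_add_of_pos_right a hδ)] with c hc hac hcδ hcb
  have hac : a < c := hac
  set y : ℝ → F := fun t => if t ≤ a then x a + (R - A a) (x a) else x t with hy
  have hyt : ∀ t, a < t → y t = x t := fun t ht => if_neg (not_le.2 ht)
  have hya : y a = x a + (R - A a) (x a) := if_pos le_rfl
  have hysol : IsSolOn (fun t => if t ≤ a then R else A t) a c y :=
    (hx.mono le_rfl hcb).change_left (fun t ht => by simp [not_le.2 ht.1])
      (fun t ht => hyt t ht.1) (tendsto_extend hR) hR (by simp [hya])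
  have hbound : ∀ t ∈ Icc a c, ‖y t‖ ≤ max m ‖y a‖ := fun t ht => by
    rcases ht.1.eq_or_lt with rfl | hat
    · exact le_max_right _ _
    · rw [hyt t hat]
      exact (hm t ⟨hat, ht.2.trans_lt hcδ.2⟩ (ht.2.trans hcb)).trans (le_max_left _ _)
  have key := fun {s : ℝ} (hs : s ∈ Icc a c) (hys : y s = 0) =>
    hysol.eq_zero_of_small (h.isControlledBy.extend_right hR)
      (by simpa [not_le.2 hac] using hc) hbound hs hys
  constructor
  · intro hxa
    rw [← hyt c hac]
    exact key ⟨le_rfl, hac.le⟩ (by simp [hya, hxa]) c ⟨hac.le, le_rfl⟩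
  · intro hxc
    have := key ⟨hac.le, le_rfl⟩ (by rw [hyt c hac, hxc]) a ⟨le_rfl, hac.le⟩
    rw [hya] at this
    rw [← hS (x a), this, map_zero]

/-- A solution vanishes at one end of an interval iff it vanishes at the other one. -/
theorem eq_zero_iff [CompleteSpace F] (h : IsRegular A v) (hx : IsSolOn A a b x) (hab : a ≤ b) :
    x a = 0 ↔ x b = 0 := by
  refine cousin_induction (P := fun a b => (x a = 0 ↔ x b = 0)) hab (fun _ => Iff.rfl)
    (fun _ _ _ _ _ _ _ h1 h2 => h1.trans h2) (fun t ht => ?_) (fun t ht => ?_)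
  · exact h.eventually_eq_zero_iff_right (hx.mono ht.1 le_rfl) ht.2
  · have h1 := h.neg.eventually_eq_zero_iff_right (hx.mono le_rfl ht.2).neg (neg_lt_neg ht.1)
    filter_upwards [(tendsto_neg_nhdsLT (a := t)).eventually h1] with s hs has
    simpa using (hs (neg_le_neg has)).symm

theorem eqOn_of_eq [CompleteSpace F] (h : IsRegular A v) (hx : IsSolOn A a b x)
    (hy : IsSolOn A a b y) (hc : c ∈ Icc a b) (hxy : x c = y c) : ∀ t ∈ Icc a b, x t = y t := by
  intro t ht
  have hs := hx.sub hy
  refine sub_eq_zero.1 ?_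
  rcases le_total t c with htc | hct
  · exact (h.eq_zero_iff (hs.mono ht.1 hc.2) htc).2 (sub_eq_zero.2 hxy)
  · exact (h.eq_zero_iff (hs.mono hc.1 ht.2) hct).1 (sub_eq_zero.2 hxy)

/-- Existence of global solutions. -/
theorem exists_forall_isSolOn [CompleteSpace F] (h : IsRegular A v) (s : ℝ) (x₀ : F) :
    ∃ x : ℝ → F, x s = x₀ ∧ ∀ a b, IsSolOn A a b x := by
  have hn : ∀ n : ℕ, ∃ x, IsSolOn A (s - n) (s + n) x ∧ x s = x₀ := fun n => by
    have hn : (0 : ℝ) ≤ n := n.cast_nonneg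
    obtain ⟨x, hx, hxs⟩ := (h.exists_isSolOn (show s - n ≤ s by linarith)).2 x₀
    obtain ⟨y, hy, hys⟩ := (h.exists_isSolOn (show s ≤ s + n by linarith)).1 x₀
    obtain ⟨z, hz, hzx, -⟩ := hx.concat hy (hxs.trans hys.symm) (by linarith)
    exact ⟨z, hz, by rw [hzx s ⟨by linarith, le_rfl⟩, hxs]⟩
  choose X hX hXs using hn
  -- The index `⌈|t - s|⌉₊` is the least `n` with `t ∈ [s - n, s + n]`; uniqueness makes the local
  -- solutions agree.
  have key : ∀ n : ℕ, ∀ t ∈ Icc (s - n) (s + n), X n t = X ⌈|t - s|⌉₊ t := by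
    intro n t ht
    set k := ⌈|t - s|⌉₊ with hk
    have hk1 : |t - s| ≤ k := Nat.le_ceil _
    have hkn : k ≤ n := Nat.ceil_le.2 (abs_le.2 ⟨by linarith [ht.1], by linarith [ht.2]⟩)
    have hkn' : (k : ℝ) ≤ n := by exact_mod_cast hkn
    obtain ⟨h1, h2⟩ := abs_le.1 hk1
    have hk0 : (0 : ℝ) ≤ k := k.cast_nonneg
    exact h.eqOn_of_eq ((hX n).mono (by linarith) (by linarith)) (hX k) (c := s)
      ⟨by linarith, by linarith⟩ ((hXs n).trans (hXs k).symm) t ⟨by linarith, by linarith⟩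
  refine ⟨fun t => X ⌈|t - s|⌉₊ t, by simp [hXs], fun a b => ?_⟩
  obtain ⟨n, hn⟩ := exists_nat_ge (max (s - a) (b - s))
  have h1 := (le_max_left _ _).trans hn
  have h2 := (le_max_right _ _).trans hn
  exact ((hX n).congr (fun _ _ => rfl) (key n)).mono (by linarith) (by linarith)

end IsRegular

end Solutions

/-- The equation for `U` is a vector equation in the operator algebra with coefficient "left
multiplication by `A(t)`". This representation does not increase norms and preserves units. -/
theorem IsRegular.mul_left {F : Type*} [NormedAddCommGroup F] [NormedSpace ℝ F] [CompleteSpace F]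
    {A : ℝ → F →L[ℝ] F} {v : ℝ → ℝ} (h : IsRegular A v) :
    IsRegular (fun t => ContinuousLinearMap.mul ℝ (F →L[ℝ] F) (A t)) v := by
  set M := ContinuousLinearMap.mul ℝ (F →L[ℝ] F) with hM
  have hunit : ∀ B : F →L[ℝ] F, IsUnit B → IsUnit (M B) := by
    rintro _ ⟨u, rfl⟩
    refine ⟨⟨M u, M ↑u⁻¹, ?_, ?_⟩, rfl⟩ <;> ext1 C <;> simp [hM, ← mul_assoc]
  have hone : M 1 = 1 := by
    ext1 C
    simp [hM]
  refine ⟨fun s t hst => ?_, fun t L hL => ?_, fun t R hR => ?_⟩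
  · rw [← map_sub]
    exact (ContinuousLinearMap.opNorm_mul_apply_le _ _ _).trans (h.isControlledBy s t hst)
  · obtain ⟨L', hL'⟩ := h.isControlledBy.neg.exists_tendsto_nhdsGT (-t)
    have h1 : Tendsto A (𝓝[<] t) (𝓝 L') := by
      simpa [Function.comp_def] using hL'.comp tendsto_neg_nhdsLT
    rw [tendsto_nhds_unique hL ((M.continuous.tendsto L').comp h1), ← hone, ← map_sub, ← map_sub]
    exact hunit _ (h.isUnit_left t L' h1)
  · obtain ⟨R', h1⟩ := h.isControlledBy.exists_tendsto_nhdsGT t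
    rw [tendsto_nhds_unique hR ((M.continuous.tendsto R').comp h1), ← hone, ← map_sub, ← map_add]
    exact hunit _ (h.isUnit_right t R' h1)

/-! ### The equation on the half-line and its transition matrix -/

section HalfLine

variable {E : Type*} [NormedAddCommGroup E] [NormedSpace ℝ E] {A : ℝ → E →L[ℝ] E}

/-- The constant extension of a coefficient on `[0, ∞)` to the line. -/
theorem ConditionD.isRegular (hD : ConditionD A) (hA : LocallyBoundedVariationOn A (Ici 0)) :
    IsRegular (fun t => A (max t 0)) (fun t => variationOnFromTo A (Ici 0) 0 (max t 0)) where
  isControlledBy s t hst := by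
    have hs : max s 0 ∈ Ici (0 : ℝ) := mem_Ici.2 (le_max_right _ _)
    have ht : max t 0 ∈ Ici (0 : ℝ) := mem_Ici.2 (le_max_right _ _)
    have hst' : max s 0 ≤ max t 0 := max_le_max_right 0 hst
    rw [variationOnFromTo.sub_right hA self_mem_Ici ht hs, variationOnFromTo.eq_of_le _ _ hst',
      ← dist_eq_norm, dist_edist]
    exact ENNReal.toReal_mono (hA _ _ hs ht)
      (eVariationOn.edist_le A ⟨ht, hst', le_rfl⟩ ⟨hs, le_rfl, hst'⟩)
  isUnit_left t L hL := by
    -- The extension has no left jump at `t ≤ 0`, including `t = 0`, where the condition says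
    -- nothing.
    rcases le_or_gt t 0 with ht | ht
    · have h1 : Tendsto (fun s => A (max s 0)) (𝓝[<] t) (𝓝 (A 0)) := by
        refine tendsto_const_nhds.congr' ?_
        filter_upwards [self_mem_nhdsWithin] with s hs
        rw [max_eq_right ((le_of_lt hs).trans ht)]
      simp [tendsto_nhds_unique hL h1, max_eq_right ht]
    · have h1 : Tendsto A (𝓝[<] t) (𝓝 L) := by
        refine hL.congr' ?_
        filter_upwards [Ioo_mem_nhdsLT ht] with s hs
        rw [max_eq_left hs.1.le]
      rw [max_eq_left ht.le, ← leftLim_eq_of_tendsto h1]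
      exact hD.1 t ht
  isUnit_right t R hR := by
    rcases lt_or_ge t 0 with ht | ht
    · have h1 : Tendsto (fun s => A (max s 0)) (𝓝[>] t) (𝓝 (A 0)) := by
        refine tendsto_const_nhds.congr' ?_
        filter_upwards [Ioo_mem_nhdsGT ht] with s hs
        rw [max_eq_right hs.2.le]
      simp [tendsto_nhds_unique hR h1, max_eq_right ht.le]
    · have h1 : Tendsto A (𝓝[>] t) (𝓝 R) := by
        refine hR.congr' ?_
        filter_upwards [self_mem_nhdsWithin] with s hs
        rw [max_eq_left (ht.trans (le_of_lt hs))]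
      rw [max_eq_left ht, ← rightLim_eq_of_tendsto h1]
      exact hD.2 t ht

theorem isTransitionMatrix_transitionMatrix [CompleteSpace E]
    (hA : LocallyBoundedVariationOn A (Ici 0)) (hD : ConditionD A) :
    IsTransitionMatrix A (transitionMatrix A) := by
  refine Classical.epsilon_spec (p := IsTransitionMatrix A) ?_
  choose X hXs hX using fun s => (hD.isRegular hA).mul_left.exists_forall_isSolOn s (1 : E →L[ℝ] E)
  have key : ∀ s a b, 0 ≤ a → a ≤ b →
      HasKurzweilIntegralOn (fun τ r => A r * X s τ) a b (X s b - X s a) := fun s a b ha hab =>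
    (hX s a b a b le_rfl hab le_rfl).congr fun τ _ r hr => by
      simp [max_eq_left (ha.trans hr.1)]
  refine ⟨fun t s => X s t, fun t ht s hs => ⟨fun hst => ?_, fun hts => ?_⟩⟩
  · simpa [hXs] using key s s t hs hst
  · simpa [hXs] using key s t s ht hts

/-- Evaluation at `x₀` is continuous and linear, so it passes through the integral. -/
theorem IsTransitionMatrix.isSolution {U : ℝ → ℝ → E →L[ℝ] E} (hU : IsTransitionMatrix A U)
    {s : ℝ} (hs : 0 ≤ s) (x₀ : E) : IsSolution A (Ici s) (fun t => U t s x₀) := by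
  have h0 : ∀ t, s ≤ t →
      HasKurzweilIntegralOn (fun τ r => A r (U τ s x₀)) s t (U t s x₀ - x₀) := fun t ht => by
    simpa using ((hU t (hs.trans ht) s hs).1 ht).map (ContinuousLinearMap.apply ℝ E x₀)
  intro c d hcd hJ
  have hsc : s ≤ c := hJ ⟨le_rfl, hcd⟩
  have h1 := (h0 d (hsc.trans hcd)).sub_left (h0 c hsc) hsc hcd
  rw [sub_sub_sub_cancel_right] at h1
  refine ⟨fun _ => h1, fun hdc => ?_⟩
  obtain rfl := le_antisymm hcd hdc
  rw [sub_self, neg_zero]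
  exact .refl _ _

theorem IsTransitionMatrix.apply_self {U : ℝ → ℝ → E →L[ℝ] E} (hU : IsTransitionMatrix A U)
    {s : ℝ} (hs : 0 ≤ s) : U s s = 1 :=
  sub_eq_zero.1 (((hU s hs s hs).1 le_rfl).unique (.refl _ _) le_rfl)

/-- A solution is determined by its initial value. -/
theorem IsSolution.eq_of_eq [CompleteSpace E] (hA : LocallyBoundedVariationOn A (Ici 0))
    (hD : ConditionD A) {s : ℝ} (hs : 0 ≤ s) {x y : ℝ → E} (hx : IsSolution A (Ici s) x)
    (hy : IsSolution A (Ici s) y) (hxy : x s = y s) {t : ℝ} (ht : s ≤ t) : x t = y t := by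
  have key : ∀ {x : ℝ → E}, IsSolution A (Ici s) x →
      IsSolOn (fun t => A (max t 0)) s t x := fun hx c d hc hcd _ =>
    ((hx c d hcd fun r hr => hc.trans hr.1).1 hcd).congr fun τ _ r hr => by
      simp only [max_eq_left (hs.trans (hc.trans hr.1))]
  exact (hD.isRegular hA).eqOn_of_eq (key hx) (key hy) ⟨le_rfl, ht⟩ hxy t ⟨ht, le_rfl⟩

end HalfLine

end GLDE

theorem corollary3p2 {E : Type*} [NormedAddCommGroup E] [NormedSpace ℝ E]
    [FiniteDimensional ℝ E] (A : ℝ → E →L[ℝ] E)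
    (hA : LocallyBoundedVariationOn A (Set.Ici 0)) (hD : GLDE.ConditionD A) :
    GLDE.IsStable A ↔
      ∀ s₀ : ℝ, 0 ≤ s₀ → ∃ C : ℝ, 0 < C ∧
        ∀ t : ℝ, s₀ ≤ t → ‖GLDE.transitionMatrix A t s₀‖ ≤ C := by
  have : CompleteSpace E := FiniteDimensional.complete ℝ E
  have hU := GLDE.isTransitionMatrix_transitionMatrix hA hD
  refine ⟨fun h s hs => ?_, fun h s hs ε hε => ?_⟩
  · obtain ⟨δ, hδ, hst⟩ := h s hs 1 one_pos
    -- On the shell `δ / 2 ≤ ‖x‖ < δ` stability gives `‖U(t, s) x‖ < 1 ≤ (2 / δ) ‖x‖`, and scaling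
    -- extends this to all `x`.
    refine ⟨2 / δ, by positivity, fun t ht =>
      ContinuousLinearMap.opNorm_le_of_shell hδ (by positivity) (c := (2 : ℝ)) (by norm_num) ?_⟩
    intro x hx1 hx2
    have h1 := hst x hx2 _ (hU.isSolution hs x) (by simp [hU.apply_self hs]) t ht
    rw [Real.norm_ofNat, div_le_iff₀ two_pos] at hx1
    rw [div_mul_eq_mul_div, le_div_iff₀ hδ]
    nlinarith
  · obtain ⟨C, hC, hb⟩ := h s hs
    refine ⟨ε / C, by positivity, fun x₀ hx₀ x hx hxs t ht => ?_⟩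
    have h1 : x t = GLDE.transitionMatrix A t s x₀ := hx.eq_of_eq hA hD hs
      (hU.isSolution hs x₀) (by simp [hU.apply_self hs, hxs]) ht
    rw [h1]
    calc _ ≤ ‖GLDE.transitionMatrix A t s‖ * ‖x₀‖ := ContinuousLinearMap.le_opNorm _ _
      _ ≤ C * ‖x₀‖ := by gcongr; exact hb t ht
      _ < C * (ε / C) := by gcongr
      _ = ε := by field_simp
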